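/- **Theorem 9.2.** Let $n\ge 1$ and $[n]=\{1,\dots,n\}$. The *Linial graph* $L_n$ is the integral gain graph (gain group $(\mathbb Z,+)$) with vertex set $[n]$ having, for each pair $i<j$, exactly one edge $ij$, with gain $1$ in the direction from $i$ to $j$ (hence gain $-1$ from $j$ to $i$). For an integral gain graph $\Phi$ with vertex set $V$ and finite edge set $E$: - A coloration $\kappa$ of $V$ (by integers, or by elements of $\mathbb Z_q=\mathbb Z/q\mathbb Z$) is *proper* if $\kappa(w)\ne\kappa(v)+g$ for every edge from $v$ to $w$ with gain $g$. The *integral chromatic function* $\chi^{\mathbb Z}_\Phi(q)$ is the number of proper colorations $\kappa:V\to\{1,\dots,q\}\subset\mathbb Z$, and the *modular chromatic function* $\chi^{\mathrm{mod}}_\Phi(q)$ is the number of proper colorations $\kappa:V\to\mathbb Z_q$. - The *zero-free chromatic polynomial* is $\chi^*_\Phi(q)=\tilde\chi_\Phi(q,0)$, where $\tilde\chi_\Phi(q,z)=\sum_{S\subseteq E}(-1)^{|S|}q^{b(S)}z^{c(S)-b(S)}$ is the total chromatic polynomial, $c(S)$ is the number of connected components of $(V,S)$, and $b(S)$ is the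 number of those components that are balanced, i.e., in which every circle has gain $0$. The *Linial arrangement* $\mathcal L_n$ is the set of hyperplanes $x_j=x_i+1$, $1\le i<j\le n$, in $\mathbb R^n$. Its *characteristic polynomial* is $p_{\mathcal L_n}(q)=\sum_F\mu(\mathbb R^n,F)\,q^{\dim F}$, the sum being over all nonempty intersections $F$ of subsets of $\mathcal L_n$ (including $\mathbb R^n$ itself), ordered by reverse inclusion, with $\mu$ the Möbius function of this poset. Let $\Pi_n$ be the set of all partitions of $[n]$. For $\pi\in\Pi_n$ let $k=|\pi|$ be its number of blocks, and number the blocks $X_1,\dots,X_k$ so that $\min X_1<\min X_2<\dots<\min X_k$. Two blocks $X,Y$ *overlap* if neither $\max X<\min Y$ nor $\max Y<\min X$. Let $d_i=d_i(\pi)$ be the number of indices $j<i$ such that $X_j$ overlaps $X_i$. Then \begin{align*} \chi^{\mathbb Z}_{L_n}(q) &= \sum_{\pi\in\Pi_n}(q-k+1)\prod_{i=2}^k(q-k+1-d_i) && \text{for all integers } q\ge n-1,\\ \chi^{\mathrm{mod}}_{L_n}(q) &= q\sum_{\pi\in\Pi_n}\prod_{i=2}^k(q-k-d_i) && \text{for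 all integers } q\ge n,\\ \chi^*_{L_n}(q) &= q\sum_{\pi\in\Pi_n}\prod_{i=2}^k(q-k-d_i) && \text{as polynomials in } q,\\ p_{\mathcal L_n}(q) &= q\sum_{\pi\in\Pi_n}\prod_{i=2}^k(q-k-d_i) && \text{as polynomials in } q. \end{align*} -/

import Mathlib

noncomputable section

/-! ### Integral gain graphs -/

/-- An integral gain graph with vertex set `V` and edge set `E` (loops and parallel edges are
allowed). Each edge is recorded in one reference orientation, from `tail e` to `head e`, together
with its gain in that orientation; in the opposite orientation the gain is `-gain e`. -/
structure IntGainGraph (V E : Type) where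
  tail : E → V
  head : E → V
  gain : E → ℤ

namespace IntGainGraph

variable {V E : Type}

/-- A coloring with colors in the additive group `A` (the gains being read in `A`) is proper if
no edge `e` from `v` to `w` satisfies `κ w = κ v + gain e`. -/
def IsProper (Φ : IntGainGraph V E) {A : Type} [AddGroupWithOne A] (κ : V → A) : Prop :=
  ∀ e : E, κ (Φ.head e) ≠ κ (Φ.tail e) + (Φ.gain e : A)

/-- The integral chromatic function: the number of proper colorations with colors in
`{1, …, q} ⊆ ℤ`. -/
def integralChromatic (Φ : IntGainGraph V E) (q : ℕ) : ℕ :=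
  Nat.card {κ : V → ℤ // (∀ v, κ v ∈ Set.Icc 1 (q : ℤ)) ∧ Φ.IsProper κ}

/-- The modular chromatic function: the number of proper colorations with colors in `ℤ/qℤ`
(for `q ≥ 1`). -/
def modularChromatic (Φ : IntGainGraph V E) (q : ℕ) : ℕ :=
  Nat.card {κ : V → ZMod q // Φ.IsProper κ}

/-! An oriented edge is a pair `(e, b)`: the reference orientation of `e` if `b = true`, and the
opposite one if `b = false`. -/

/-- The initial vertex of an oriented edge. -/
def src (Φ : IntGainGraph V E) (d : E × Bool) : V := if d.2 then Φ.tail d.1 else Φ.head d.1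

/-- The final vertex of an oriented edge. -/
def tgt (Φ : IntGainGraph V E) (d : E × Bool) : V := if d.2 then Φ.head d.1 else Φ.tail d.1

/-- The gain of an oriented edge. -/
def orientedGain (Φ : IntGainGraph V E) (d : E × Bool) : ℤ :=
  if d.2 then Φ.gain d.1 else -Φ.gain d.1

/-- The list of oriented edges is a walk from the first vertex to the second one. -/
def IsWalk (Φ : IntGainGraph V E) : V → List (E × Bool) → V → Prop
  | u, [], v => u = v
  | u, d :: l, v => Φ.src d = u ∧ Φ.IsWalk (Φ.tgt d) l v

/-- The list of oriented edges traverses a circle based at `u`: a nonempty closed walk with no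
repeated edge and no repeated vertex. Loops (length one) and pairs of parallel links (length two)
are circles. -/
def IsCircle (Φ : IntGainGraph V E) (u : V) (l : List (E × Bool)) : Prop :=
  l ≠ [] ∧ Φ.IsWalk u l u ∧ (l.map Prod.fst).Nodup ∧ (l.map Φ.src).Nodup

/-- The gain of a walk. -/
def walkGain (Φ : IntGainGraph V E) (l : List (E × Bool)) : ℤ := (l.map Φ.orientedGain).sum

/-- The equivalence relation generated by adjacency in the spanning subgraph `(V, S)`. -/
def connectivity (Φ : IntGainGraph V E) (S : Finset E) : Setoid V :=
  Relation.EqvGen.setoid fun v w => ∃ e ∈ S, Φ.tail e = v ∧ Φ.head e = w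

/-- The connected components of the spanning subgraph `(V, S)`. -/
abbrev Component (Φ : IntGainGraph V E) (S : Finset E) : Type := Quotient (Φ.connectivity S)

/-- A component of `(V, S)` is balanced if every circle in it has gain `0`. -/
def IsBalancedComponent (Φ : IntGainGraph V E) (S : Finset E) (C : Φ.Component S) : Prop :=
  ∀ (u : V) (l : List (E × Bool)), (Quotient.mk (Φ.connectivity S) u : Φ.Component S) = C →
    Φ.IsCircle u l → (∀ d ∈ l, d.1 ∈ S) → Φ.walkGain l = 0

/-- The number `c(S)` of components of `(V, S)`. -/
def numComponents (Φ : IntGainGraph V E) (S : Finset E) : ℕ := Nat.card (Φ.Component S)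

/-- The number `b(S)` of balanced components of `(V, S)`. -/
def numBalanced (Φ : IntGainGraph V E) (S : Finset E) : ℕ :=
  Nat.card {C : Φ.Component S // Φ.IsBalancedComponent S C}

open Polynomial in
/-- The total chromatic polynomial `∑_{S ⊆ E} (-1)^|S| q^b(S) z^(c(S) - b(S))`, as a polynomial
in `z` with coefficients in `ℤ[q]`. -/
def totalChromatic [Fintype E] (Φ : IntGainGraph V E) : ℤ[X][X] :=
  ∑ S : Finset E, (-1 : ℤ[X][X]) ^ S.card * C (X ^ Φ.numBalanced S) *
    X ^ (Φ.numComponents S - Φ.numBalanced S)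

open Polynomial in
/-- The zero-free chromatic polynomial, obtained from the total one by setting `z = 0`. -/
def zeroFreeChromatic [Fintype E] (Φ : IntGainGraph V E) : ℤ[X] := Φ.totalChromatic.eval 0

end IntGainGraph

/-- The Linial graph of order `n`: the complete graph on `n` linearly ordered vertices, each edge
having gain `1` in the upward orientation. -/
def linialGraph (n : ℕ) : IntGainGraph (Fin n) {p : Fin n × Fin n // p.1 < p.2} where
  tail e := e.1.1
  head e := e.1.2
  gain _ := 1

/-! ### Affine hyperplane arrangements -/

section Arrangement

variable {W : Type} [AddCommGroup W] [Module ℝ W]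

/-- The intersection poset of an arrangement: the nonempty intersections of subsets of the
arrangement (the empty subset giving the whole space), ordered by reverse inclusion. -/
def IntersectionPoset (A : Finset (AffineSubspace ℝ W)) : Type :=
  {F : AffineSubspace ℝ W // F ≠ ⊥ ∧ ∃ B ⊆ A, F = sInf (B : Set (AffineSubspace ℝ W))}

namespace IntersectionPoset

variable (A : Finset (AffineSubspace ℝ W))

instance : PartialOrder (IntersectionPoset A) where
  le F G := G.1 ≤ F.1
  le_refl F := le_refl F.1
  le_trans _ _ _ h₁ h₂ := le_trans h₂ h₁
  le_antisymm _ _ h₁ h₂ := Subtype.ext (le_antisymm h₂ h₁)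

instance : Finite (IntersectionPoset A) := by
  have hfin : Set.Finite {F : AffineSubspace ℝ W |
      F ≠ ⊥ ∧ ∃ B ⊆ A, F = sInf (B : Set (AffineSubspace ℝ W))} := by
    refine (A.powerset.finite_toSet.image
      (fun B : Finset (AffineSubspace ℝ W) => sInf (B : Set (AffineSubspace ℝ W)))).subset ?_
    rintro F ⟨-, B, hB, rfl⟩
    exact ⟨B, by simpa using hB, rfl⟩
  exact hfin.to_subtype

instance : Fintype (IntersectionPoset A) := Fintype.ofFinite _

open scoped Classical in
instance : LocallyFiniteOrder (IntersectionPoset A) := Fintype.toLocallyFiniteOrder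

/-- The whole space, which is the least element of the intersection poset. -/
def whole : IntersectionPoset A :=
  ⟨⊤, fun h => by
    have h0 : (0 : W) ∈ (⊤ : AffineSubspace ℝ W) := AffineSubspace.mem_top ℝ W 0
    rw [h] at h0
    exact AffineSubspace.notMem_bot ℝ W 0 h0, ∅, by simp, by simp⟩

end IntersectionPoset

open Polynomial in
open scoped Classical in
/-- The characteristic polynomial `∑_F μ(whole, F) q^(dim F)` of an arrangement, summed over the
intersection poset, with `μ` its Möbius function. -/
def arrangementCharpoly (A : Finset (AffineSubspace ℝ W)) : ℤ[X] :=
  ∑ F : IntersectionPoset A,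
    C (IncidenceAlgebra.mu ℤ (IntersectionPoset.whole A) F) * X ^ Module.finrank ℝ F.1.direction

end Arrangement

/-- The set `{x ∈ ℝ^V : x_j = x_i + g}` (an affine hyperplane when `i ≠ j`). -/
def affinographicHyperplane {V : Type} (i j : V) (g : ℝ) : AffineSubspace ℝ (V → ℝ) where
  carrier := {x | x j = x i + g}
  smul_vsub_vadd_mem' := by
    intro c p₁ p₂ p₃ h₁ h₂ h₃
    simp only [Set.mem_ofPred_eq, vsub_eq_sub, vadd_eq_add, Pi.add_apply, Pi.smul_apply,
      Pi.sub_apply, smul_eq_mul] at *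
    rw [h₁, h₂, h₃]
    ring

open scoped Classical in
/-- The affinographic arrangement of an integral gain graph: the hyperplanes `x_j = x_i + g` for
the links from `i` to `j` with gain `g`. -/
def IntGainGraph.arrangement {V E : Type} [Fintype E] (Φ : IntGainGraph V E) :
    Finset (AffineSubspace ℝ (V → ℝ)) :=
  (Finset.univ.filter fun e : E => Φ.tail e ≠ Φ.head e).image fun e =>
    affinographicHyperplane (Φ.tail e) (Φ.head e) (Φ.gain e : ℝ)

/-! ### Partitions and lower degrees -/

section Partitions

variable {n : ℕ}

/-- `X` lies entirely below `Y`. -/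
def BlockLT (X Y : Finset (Fin n)) : Prop := ∀ c ∈ X, ∀ d ∈ Y, c < d

/-- Two blocks overlap if neither lies entirely below the other. -/
def Overlap (X Y : Finset (Fin n)) : Prop := ¬ BlockLT X Y ∧ ¬ BlockLT Y X

/-- The number of the block `X` when the blocks of the partition are numbered `1, …, k` in
increasing order of their least elements. -/
def blockIndex (π : Finpartition (Finset.univ : Finset (Fin n))) (X : Finset (Fin n)) : ℕ :=
  (π.parts.filter fun Y => Y.min ≤ X.min).card

open scoped Classical in
/-- The lower degree of the block `X`: the number of blocks that overlap `X` and have a smaller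
number. -/
def lowerDegree (π : Finpartition (Finset.univ : Finset (Fin n))) (X : Finset (Fin n)) : ℕ :=
  (π.parts.filter fun Y => blockIndex π Y < blockIndex π X ∧ Overlap X Y).card

/-- The blocks numbered `2, …, k`. -/
def laterBlocks (π : Finpartition (Finset.univ : Finset (Fin n))) : Finset (Finset (Fin n)) :=
  π.parts.filter fun X => 2 ≤ blockIndex π X

end Partitions

end

/-! The arguments for the four formulas are as follows.

*Colorings with integer colors.* A coloration of the Linial graph is proper exactly when each
color class `c + 1` lies entirely below the color class `c`. Fix the partition `π` into nonempty
color classes and let `k` be its number of blocks. The `q - k` unused colors cut `{1, …, q}` into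
`q - k + 1` runs of used colors, and along each run the blocks decrease. Hence a coloration is the
same thing as an assignment of the blocks to the runs such that overlapping blocks go to different
runs: blocks in a common run are pairwise comparable, and their order in it is forced
(`gapEquiv`). This is a coloring of the overlap graph of the blocks, which is an interval graph:
the blocks that overlap `X` and have a smaller least element than `X` overlap one another. So
coloring the blocks greedily in the order of their least elements gives a product
(`card_listColorings`, `card_separating`).

*Colorings with colors in `ℤ/qℤ`.* By translation the color of the least vertex may be fixed,
which gives the factor `q`. If that color is `-1`, then no vertex has color `0`, and what is left
is an integral coloration with colors `1, …, q - 1` in which the least vertex has color `q - 1`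
(`modularChromatic_eq_mul`). Under the bijection above this says that the first block lies in the
last run, so that the factor of the first block becomes `1` (`card_pinned`).

*The zero-free polynomial.* For every integral gain graph inclusion-exclusion writes
`χ^mod(q)` as a signed sum over edge sets `S` of the number of `ℤ/qℤ`-valued potentials of `S`.
For large `q` there are `q^c(S)` of these if `S` is balanced and none otherwise, so the sum is the
value of the zero-free polynomial at `q` (`IntGainGraph.eval_zeroFreeChromatic`). Here one needs
that a set in which every circle has gain `0` has an integral potential
(`IntGainGraph.IsBalancedSet.exists_isPotential`).

*The arrangement.* Whitney's theorem (`arrangementCharpoly_eq_sum`) writes the characteristic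
polynomial as a signed sum over the subarrangements with nonempty intersection. The intersection
of the hyperplanes of an edge set `S` consists of the real potentials of `S`. It is nonempty
exactly when `S` is balanced, and then it has dimension `c(S)`, so the sum is the zero-free
polynomial (`IntGainGraph.arrangementCharpoly_arrangement`). -/

/-! ### List colorings along a perfect elimination order -/

open Finset in
/-- List colorings of a graph whose vertices are ordered by `rank`, with `R y x` the adjacency of
`x` to a vertex `y` of smaller rank. If the smaller neighbors of each vertex form a clique and
their lists are contained in its own, then they always rule out distinct colors of its list, so
the greedy count is exact. Colorings of `s` are encoded as functions on all of `α` that vanish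
off `s`. -/
theorem card_listColorings {α ι : Type*} [Fintype α] [DecidableEq α] [LinearOrder ι]
    (rank : α → ι) (hrank : Function.Injective rank) (R : α → α → Prop) [DecidableRel R]
    (hclique : ∀ x y z, rank y < rank z → rank z < rank x → R y x → R z x → R y z)
    (L : α → Finset ℤ) (hL : ∀ x y, rank y < rank x → R y x → L y ⊆ L x) (s : Finset α) :
    (#{f ∈ Fintype.piFinset (fun x => if x ∈ s then L x else {0}) |
        ∀ y ∈ s, ∀ z ∈ s, rank y < rank z → R y z → f y ≠ f z} : ℤ) =
      ∏ x ∈ s, ((#(L x) : ℤ) - (#{y ∈ s | rank y < rank x ∧ R y x} : ℤ)) := by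
  refine Finset.induction_on_max_value rank s (by simp) fun a s ha hmax ih => ?_
  · have hlt : ∀ x ∈ s, rank x < rank a := fun x hx =>
      lt_of_le_of_ne (hmax x hx) fun h => ha (hrank h ▸ hx)
    rw [Finset.prod_insert ha]
    have h1 : ∀ x ∈ s, {y ∈ insert a s | rank y < rank x ∧ R y x} =
        {y ∈ s | rank y < rank x ∧ R y x} := by
      intro x hx
      rw [Finset.filter_insert, if_neg]
      exact fun h => lt_asymm h.1 (hlt x hx)
    have h2 : {y ∈ insert a s | rank y < rank a ∧ R y a} = {y ∈ s | R y a} := by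
      rw [Finset.filter_insert, if_neg (fun h => lt_irrefl _ h.1)]
      exact Finset.filter_congr fun y hy => by simp [hlt y hy]
    rw [Finset.prod_congr rfl fun x hx => by rw [h1 x hx], ← ih, h2, mul_comm]
    rw [Finset.card_eq_sum_card_fiberwise (f := fun f => Function.update f a 0)
      (t := {f ∈ Fintype.piFinset (fun x => if x ∈ s then L x else {0}) |
        ∀ y ∈ s, ∀ z ∈ s, rank y < rank z → R y z → f y ≠ f z})]
    · push_cast
      rw [Finset.sum_congr rfl (g := fun _ => ((#(L a) : ℤ) - (#{y ∈ s | R y a} : ℤ)))]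
      · rw [Finset.sum_const, nsmul_eq_mul]
      intro f hf
      simp only [Finset.mem_filter, Fintype.mem_piFinset] at hf
      obtain ⟨hfL, hfp⟩ := hf
      have hfa : f a = 0 := by simpa [ha] using hfL a
      have hfs : ∀ x ∈ s, f x ∈ L x := fun x hx => by simpa [hx] using hfL x
      have hsub : {y ∈ s | R y a}.image f ⊆ L a := by
        intro c hc
        simp only [Finset.mem_image, Finset.mem_filter] at hc
        obtain ⟨y, ⟨hy, hya⟩, rfl⟩ := hc
        exact hL a y (hlt y hy) hya (hfs y hy)
      have hinj : Set.InjOn f (s.filter fun y => R y a) := by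
        intro y hy z hz hyz
        simp only [Finset.coe_filter, Set.mem_ofPred_eq] at hy hz
        by_contra hne
        rcases lt_trichotomy (rank y) (rank z) with h | h | h
        · exact hfp y hy.1 z hz.1 h (hclique a y z h (hlt z hz.1) hy.2 hz.2) hyz
        · exact hne (hrank h)
        · exact hfp z hz.1 y hy.1 h (hclique a z y h (hlt y hy.1) hz.2 hy.2) hyz.symm
      rw [← Finset.card_image_of_injOn hinj, ← Nat.cast_sub (Finset.card_le_card hsub),
        ← Finset.card_sdiff_of_subset hsub]
      congr 1
      refine Finset.card_nbij' (fun g => g a) (fun c => Function.update f a c) ?_ ?_ ?_ ?_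
      · intro g hg
        simp only [Finset.coe_filter, Finset.mem_filter, Fintype.mem_piFinset,
          Set.mem_ofPred_eq] at hg
        obtain ⟨⟨hgL, hgp⟩, rfl⟩ := hg
        simp only [Finset.coe_sdiff, Set.mem_sdiff, Finset.mem_coe, Finset.mem_image,
          Finset.mem_filter, not_exists, not_and]
        refine ⟨by simpa using hgL a, fun y hy => ?_⟩
        have hya : y ≠ a := fun h => ha (h ▸ hy.1)
        rw [Function.update_of_ne hya]
        exact hgp y (Finset.mem_insert_of_mem hy.1) a (Finset.mem_insert_self _ _)
          (hlt y hy.1) hy.2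
      · intro c hc
        simp only [Finset.coe_sdiff, Set.mem_sdiff, Finset.mem_coe, Finset.mem_image,
          Finset.mem_filter, not_exists, not_and] at hc
        simp only [Finset.coe_filter, Finset.mem_filter, Fintype.mem_piFinset,
          Set.mem_ofPred_eq]
        refine ⟨⟨fun x => ?_, ?_⟩, ?_⟩
        · by_cases hx : x = a
          · subst hx; simpa using hc.1
          · simpa [hx] using hfL x
        · intro y hy z hz hyz hR
          rcases Finset.mem_insert.1 hy with rfl | hys
          · rcases Finset.mem_insert.1 hz with rfl | hzs
            · exact absurd hyz (lt_irrefl _)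
            · exact absurd hyz (lt_asymm (hlt z hzs))
          · have hya : y ≠ a := fun h => ha (h ▸ hys)
            rw [Function.update_of_ne hya]
            rcases Finset.mem_insert.1 hz with rfl | hzs
            · rw [Function.update_self]
              exact hc.2 y ⟨hys, hR⟩
            · have hza : z ≠ a := fun h => ha (h ▸ hzs)
              rw [Function.update_of_ne hza]
              exact hfp y hys z hzs hyz hR
        · rw [Function.update_idem, ← hfa, Function.update_eq_self]
      · intro g hg
        simp only [Finset.coe_filter, Set.mem_ofPred_eq] at hg
        rw [← hg.2]
        simp only [Function.update_idem, Function.update_eq_self]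
      · intro c _
        simp
    · intro g hg
      simp only [Finset.coe_filter, Set.mem_ofPred_eq, Fintype.mem_piFinset] at hg ⊢
      refine ⟨fun x => ?_, ?_⟩
      · by_cases hx : x = a
        · subst hx; simp [ha]
        · simpa [hx] using hg.1 x
      · intro y hy z hz hyz hR
        have hya : y ≠ a := fun h => ha (h ▸ hy)
        have hza : z ≠ a := fun h => ha (h ▸ hz)
        rw [Function.update_of_ne hya, Function.update_of_ne hza]
        exact hg.2 y (Finset.mem_insert_of_mem hy) z (Finset.mem_insert_of_mem hz) hyz hR

/-! ### Descending colorings and gaps -/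

section Gaps

open Finset

variable {α : Type*} [Fintype α] {r : α → α → Prop}

open scoped Classical in
/-- For an injective `g`, the number of the run of consecutive values of `g` to which `g x`
belongs: `g x` less the number of smaller values. -/
noncomputable def gapIndex (g : α → ℤ) (x : α) : ℤ := g x - #{y | g y < g x}

open scoped Classical in
/-- The inverse of `gapIndex`: the elements are listed by increasing `f` and, where `f` is
constant, decreasingly for `r`; each is moved up by the number
of elements before it. -/
noncomputable def spreadOut (r : α → α → Prop) (f : α → ℤ) (x : α) : ℤ :=
  f x + #{y | f y < f x ∨ (f y = f x ∧ r x y)}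

/-- `g` is injective, and consecutive values are taken at elements that decrease for `r`. -/
def IsDescending (r : α → α → Prop) (g : α → ℤ) : Prop :=
  Function.Injective g ∧ ∀ x y, g y = g x + 1 → r y x

/-- `f` takes distinct values at elements that are incomparable for `r`. -/
def SeparatesIncomparable (r : α → α → Prop) (f : α → ℤ) : Prop :=
  ∀ x y, x ≠ y → f x = f y → r x y ∨ r y x

open scoped Classical in
theorem gapIndex_sub_gapIndex (g : α → ℤ) {x y : α} (h : g x < g y) :
    gapIndex g y - gapIndex g x = g y - g x - #{z | g x ≤ g z ∧ g z < g y} := by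
  have h1 : #{z | g z < g y} = #{z | g z < g x} + #{z | g x ≤ g z ∧ g z < g y} := by
    rw [← Finset.card_union_of_disjoint]
    · congr 1
      ext z
      simp only [mem_filter, mem_univ, true_and, mem_union]
      constructor
      · intro hz
        rcases lt_or_ge (g z) (g x) with h' | h'
        · exact Or.inl h'
        · exact Or.inr ⟨h', hz⟩
      · rintro (hz | hz)
        · exact hz.trans h
        · exact hz.2
    · rw [Finset.disjoint_left]
      intro z hz hz'
      simp only [mem_filter, mem_univ, true_and] at hz hz'
      exact absurd hz (not_lt.2 hz'.1)
  simp only [gapIndex, h1]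
  push_cast
  ring

open scoped Classical in
theorem card_between_le (g : α → ℤ) (hg : Function.Injective g) (a b : ℤ) (hab : a ≤ b) :
    (#{z | a ≤ g z ∧ g z < b} : ℤ) ≤ b - a := by
  rw [← Int.toNat_of_nonneg (sub_nonneg.2 hab), ← Int.card_Ico, Nat.cast_le,
    ← Finset.card_image_of_injective _ hg]
  refine Finset.card_le_card fun c hc => ?_
  simp only [mem_image, mem_filter, mem_univ, true_and] at hc
  obtain ⟨z, hz, rfl⟩ := hc
  exact Finset.mem_Ico.2 hz

theorem gapIndex_mono {g : α → ℤ} (hg : Function.Injective g) {x y : α} (h : g x < g y) :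
    gapIndex g x ≤ gapIndex g y := by
  have h1 := gapIndex_sub_gapIndex g h
  have h2 := card_between_le g hg (g x) (g y) h.le
  linarith

/-- Elements with the same gap index lie in one run of consecutive values of `g`, along which
`r` decreases. -/
theorem rel_of_gapIndex_eq (htrans : ∀ x y z, r x y → r y z → r x z) {g : α → ℤ}
    (hg : IsDescending r g) {x y : α} (h : g x < g y) (heq : gapIndex g x = gapIndex g y) :
    r y x := by
  classical
  have h1 := gapIndex_sub_gapIndex g h
  -- Equal gap indices leave no room: every integer in `[g x, g y)` is a value of `g`.
  have himg : {z ∈ (univ : Finset α) | g x ≤ g z ∧ g z < g y}.image g =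
      Finset.Ico (g x) (g y) := by
    refine Finset.eq_of_subset_of_card_le (fun c hc => ?_) ?_
    · simp only [mem_image, mem_filter, mem_univ, true_and] at hc
      obtain ⟨z, hz, rfl⟩ := hc
      exact Finset.mem_Ico.2 hz
    · rw [Finset.card_image_of_injective _ hg.1, Int.card_Ico]
      omega
  have key : ∀ c, g x + 1 ≤ c → c ≤ g y → ∀ z, g z = c → r z x := by
    intro c hc
    induction c, hc using Int.leInduction with
    | base => exact fun _ z hz => hg.2 x z hz
    | succ c hc ih =>
      intro hcy z hz
      have hmem : c ∈ {z ∈ (univ : Finset α) | g x ≤ g z ∧ g z < g y}.image g := by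
        rw [himg, Finset.mem_Ico]; omega
      obtain ⟨w, -, hw⟩ := Finset.mem_image.1 hmem
      exact htrans z w x (hg.2 w z (by rw [hz, hw])) (ih (by omega) w hw)
  exact key (g y) h le_rfl y rfl

theorem separatesIncomparable_gapIndex (htrans : ∀ x y z, r x y → r y z → r x z) {g : α → ℤ}
    (hg : IsDescending r g) : SeparatesIncomparable r (gapIndex g) := by
  intro x y hne heq
  rcases lt_trichotomy (g x) (g y) with h | h | h
  · exact Or.inr (rel_of_gapIndex_eq htrans hg h heq)
  · exact absurd (hg.1 h) hne
  · exact Or.inl (rel_of_gapIndex_eq htrans hg h heq.symm)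

theorem spreadOut_gapIndex (htrans : ∀ x y z, r x y → r y z → r x z) (hirr : ∀ x, ¬ r x x)
    {g : α → ℤ} (hg : IsDescending r g) : spreadOut r (gapIndex g) = g := by
  classical
  funext x
  have hset : {y ∈ (univ : Finset α) | gapIndex g y < gapIndex g x ∨
      (gapIndex g y = gapIndex g x ∧ r x y)} = {y ∈ (univ : Finset α) | g y < g x} := by
    ext y
    simp only [mem_filter, mem_univ, true_and]
    constructor
    · rintro (h | ⟨h, hr⟩)
      · rcases lt_trichotomy (g y) (g x) with h' | h' | h'
        · exact h'
        · rw [hg.1 h'] at h; exact absurd h (lt_irrefl _)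
        · exact absurd h (not_lt.2 (gapIndex_mono hg.1 h'))
      · rcases lt_trichotomy (g y) (g x) with h' | h' | h'
        · exact h'
        · rw [hg.1 h'] at hr; exact absurd hr (hirr _)
        · exact absurd (htrans _ _ _ hr (rel_of_gapIndex_eq htrans hg h' h.symm)) (hirr _)
    · intro h
      rcases (gapIndex_mono hg.1 h).lt_or_eq with h' | h'
      · exact Or.inl h'
      · exact Or.inr ⟨h', rel_of_gapIndex_eq htrans hg h h'⟩
  rw [spreadOut]
  rw [hset, gapIndex]
  ring

/-- `spreadOut r f` induces the lexicographic order that defines it. -/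
theorem spreadOut_lt_iff (htrans : ∀ x y z, r x y → r y z → r x z) (hirr : ∀ x, ¬ r x x)
    {f : α → ℤ} (hf : SeparatesIncomparable r f) (x y : α) :
    spreadOut r f y < spreadOut r f x ↔ f y < f x ∨ (f y = f x ∧ r x y) := by
  classical
  have key : ∀ x y, (f y < f x ∨ (f y = f x ∧ r x y)) → spreadOut r f y < spreadOut r f x := by
    intro x y hyx
    have hle : f y ≤ f x := by rcases hyx with h | h <;> omega
    have hss : {z ∈ (univ : Finset α) | f z < f y ∨ (f z = f y ∧ r y z)} ⊂
        {z ∈ (univ : Finset α) | f z < f x ∨ (f z = f x ∧ r x z)} := by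
      refine Finset.ssubset_iff_of_subset ?_ |>.2 ⟨y, by simpa using hyx, by simp [hirr]⟩
      intro z
      simp only [mem_filter, mem_univ, true_and]
      rintro (h | h)
      · exact Or.inl (h.trans_le hle)
      · rcases hyx with h' | h'
        · exact Or.inl (h.1 ▸ h')
        · exact Or.inr ⟨h.1.trans h'.1, htrans _ _ _ h'.2 h.2⟩
    have := Finset.card_lt_card hss
    rw [spreadOut, spreadOut]
    omega
  refine ⟨fun h => ?_, key x y⟩
  by_contra hn
  push Not at hn
  rcases hn.1.lt_or_eq with h' | h'
  · exact lt_asymm h (key y x (Or.inl h'))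
  · by_cases hxy : x = y
    · subst hxy; exact lt_irrefl _ h
    · rcases hf x y hxy h' with h'' | h''
      · exact hn.2 h'.symm h''
      · exact lt_asymm h (key y x (Or.inr ⟨h', h''⟩))

theorem isDescending_spreadOut (htrans : ∀ x y z, r x y → r y z → r x z) (hirr : ∀ x, ¬ r x x)
    {f : α → ℤ} (hf : SeparatesIncomparable r f) : IsDescending r (spreadOut r f) := by
  classical
  have hlt := spreadOut_lt_iff htrans hirr hf
  refine ⟨fun x y h => ?_, fun x y h => ?_⟩
  · by_contra hxy
    have h1 := hlt x y
    have h2 := hlt y x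
    rw [h] at h1 h2
    simp only [lt_irrefl, false_iff, not_or, not_and] at h1 h2
    have heq : f x = f y := le_antisymm (not_lt.1 h1.1) (not_lt.1 h2.1)
    rcases hf x y hxy heq with h' | h'
    · exact h1.2 heq.symm h'
    · exact h2.2 heq h'
  · have hxy : spreadOut r f x < spreadOut r f y := by omega
    rcases (hlt y x).1 hxy with h' | h'
    · exfalso
      have hss : {z ∈ (univ : Finset α) | f z < f x ∨ (f z = f x ∧ r x z)} ⊂
          {z ∈ (univ : Finset α) | f z < f y ∨ (f z = f y ∧ r y z)} := by
        refine Finset.ssubset_iff_of_subset ?_ |>.2 ⟨x, by simpa using Or.inl h', by simp [hirr]⟩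
        intro z
        simp only [mem_filter, mem_univ, true_and]
        intro hz
        left
        omega
      have := Finset.card_lt_card hss
      rw [spreadOut, spreadOut] at h
      omega
    · exact h'.2

theorem gapIndex_spreadOut (htrans : ∀ x y z, r x y → r y z → r x z) (hirr : ∀ x, ¬ r x x)
    {f : α → ℤ} (hf : SeparatesIncomparable r f) : gapIndex (spreadOut r f) = f := by
  classical
  funext x
  rw [gapIndex]
  simp only [spreadOut_lt_iff htrans hirr hf]
  rw [spreadOut]
  ring

/-- Descending injections correspond to the functions that separate incomparable elements. -/
noncomputable def gapEquiv (htrans : ∀ x y z, r x y → r y z → r x z) (hirr : ∀ x, ¬ r x x) :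
    {g : α → ℤ // IsDescending r g} ≃ {f : α → ℤ // SeparatesIncomparable r f} where
  toFun g := ⟨gapIndex g.1, separatesIncomparable_gapIndex htrans g.2⟩
  invFun f := ⟨spreadOut r f.1, isDescending_spreadOut htrans hirr f.2⟩
  left_inv g := Subtype.ext (spreadOut_gapIndex htrans hirr g.2)
  right_inv f := Subtype.ext (gapIndex_spreadOut htrans hirr f.2)

/-- The `k` values of `g` fit into `{1, …, N}` exactly when the gap indices fit into the
`N - k + 1` gaps. -/
theorem mem_Icc_iff_gapIndex_mem_Icc {g : α → ℤ} (hg : Function.Injective g) (N : ℤ) :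
    (∀ x, g x ∈ Set.Icc 1 N) ↔
      ∀ x, gapIndex g x ∈ Set.Icc 1 (N - Fintype.card α + 1) := by
  classical
  have hge : ∀ x, (#{y | g y < g x} : ℤ) + #{y | g x ≤ g y} = Fintype.card α := by
    intro x
    have := Finset.card_filter_add_card_filter_not (s := (univ : Finset α)) (fun y => g y < g x)
    simp only [not_lt, Finset.card_univ] at this
    exact_mod_cast this
  constructor
  · intro h x
    have h1 := card_between_le g hg 1 (g x) (h x).1
    have h2 := card_between_le g hg (g x) (N + 1) (by linarith [(h x).2])
    have e1 : {z ∈ (univ : Finset α) | 1 ≤ g z ∧ g z < g x} = {z ∈ (univ : Finset α) | g z < g x} :=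
      Finset.filter_congr fun z _ => and_iff_right (h z).1
    have e2 : {z ∈ (univ : Finset α) | g x ≤ g z ∧ g z < N + 1} =
        {z ∈ (univ : Finset α) | g x ≤ g z} :=
      Finset.filter_congr fun z _ => and_iff_left (Int.lt_add_one_iff.2 (h z).2)
    rw [e1] at h1
    rw [e2] at h2
    have h3 := hge x
    rw [gapIndex]
    constructor <;> linarith
  · intro h x
    have h1 := h x
    rw [gapIndex] at h1
    have h2 := hge x
    have h3 : 0 < #{y | g x ≤ g y} := Finset.card_pos.2 ⟨x, by simp⟩
    constructor
    · linarith [h1.1, Int.natCast_nonneg #{y | g y < g x}]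
    · have := h1.2
      have h3' : (1 : ℤ) ≤ #{y | g x ≤ g y} := by exact_mod_cast h3
      linarith

/-- An element with nothing below it comes last in its run, so it takes the largest color exactly
when it lies in the last gap. -/
theorem eq_top_iff_gapIndex_eq {g : α → ℤ} (hg : IsDescending r g) {x₀ : α}
    (htrans : ∀ x y z, r x y → r y z → r x z)
    (hx₀ : ∀ y, ¬ r y x₀) {N : ℤ} (hN : ∀ x, g x ∈ Set.Icc 1 N) :
    g x₀ = N ↔ gapIndex g x₀ = N - Fintype.card α + 1 := by
  classical
  have hb := (mem_Icc_iff_gapIndex_mem_Icc hg.1 N).1 hN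
  have hone : ∀ x, (∀ y, g y ≤ g x) → gapIndex g x = g x - Fintype.card α + 1 := by
    intro x hx
    have : {y ∈ (univ : Finset α) | g y < g x} = univ.erase x := by
      ext y
      simp only [mem_filter, mem_univ, true_and, mem_erase, and_true]
      exact ⟨fun h e => by simp [e] at h, fun h => lt_of_le_of_ne (hx y) fun e => h (hg.1 e)⟩
    rw [gapIndex, this, Finset.card_erase_of_mem (mem_univ x), Finset.card_univ,
      Nat.cast_sub (Fintype.card_pos_iff.2 ⟨x⟩)]
    push_cast
    ring
  constructor
  · intro h
    rw [hone x₀ (fun y => h ▸ (hN y).2), h]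
  · intro h
    have hmax : ∀ y, g y ≤ g x₀ := by
      intro y
      by_contra hlt
      push Not at hlt
      have h1 := gapIndex_mono hg.1 hlt
      have h2 := (hb y).2
      exact hx₀ y (rel_of_gapIndex_eq htrans hg hlt (by omega))
    have := hone x₀ hmax
    linarith

end Gaps

/-! ### Blocks of a partition and their overlap graph -/

section Blocks

variable {n : ℕ}

theorem BlockLT.trans {X Y Z : Finset (Fin n)} (hY : Y.Nonempty) (h₁ : BlockLT X Y)
    (h₂ : BlockLT Y Z) : BlockLT X Z := by
  obtain ⟨y, hy⟩ := hY
  exact fun c hc d hd => (h₁ c hc y hy).trans (h₂ y hy d hd)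

theorem not_blockLT_self {X : Finset (Fin n)} (hX : X.Nonempty) : ¬ BlockLT X X := by
  obtain ⟨x, hx⟩ := hX
  exact fun h => lt_irrefl x (h x hx x hx)

theorem min_lt_min_iff {X Y : Finset (Fin n)} (hX : X.Nonempty) (hY : Y.Nonempty) :
    Y.min < X.min ↔ ∃ c ∈ Y, ∀ d ∈ X, c < d := by
  rw [← Finset.coe_min' hX, ← Finset.coe_min' hY, WithTop.coe_lt_coe]
  constructor
  · exact fun h => ⟨_, Y.min'_mem hY, fun d hd => h.trans_le (X.min'_le d hd)⟩
  · rintro ⟨c, hc, h⟩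
    exact (Y.min'_le c hc).trans_lt (h _ (X.min'_mem hX))

variable (π : Finpartition (Finset.univ : Finset (Fin n)))

theorem min_injOn_parts : Set.InjOn Finset.min (π.parts : Set (Finset (Fin n))) := by
  intro X hX Y hY h
  have hX' := π.nonempty_of_mem_parts hX
  have hY' := π.nonempty_of_mem_parts hY
  rw [← Finset.coe_min' hX', ← Finset.coe_min' hY', WithTop.coe_inj] at h
  exact π.eq_of_mem_parts hX hY (X.min'_mem hX') (h ▸ Y.min'_mem hY')

theorem blockIndex_lt_iff {X Y : Finset (Fin n)} (hX : X ∈ π.parts) :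
    blockIndex π Y < blockIndex π X ↔ Y.min < X.min := by
  constructor
  · intro h
    by_contra hn
    refine absurd h (not_lt.2 (Finset.card_le_card fun Z hZ => ?_))
    rw [Finset.mem_filter] at hZ ⊢
    exact ⟨hZ.1, hZ.2.trans (not_lt.1 hn)⟩
  · intro h
    refine Finset.card_lt_card ((Finset.ssubset_iff_of_subset fun Z hZ => ?_).2 ⟨X, ?_, ?_⟩)
    · rw [Finset.mem_filter] at hZ ⊢
      exact ⟨hZ.1, hZ.2.trans h.le⟩
    · exact Finset.mem_filter.2 ⟨hX, le_rfl⟩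
    · exact fun hmem => absurd (Finset.mem_filter.1 hmem).2 (not_le.2 h)

theorem blockIndex_injOn : Set.InjOn (blockIndex π) (π.parts : Set (Finset (Fin n))) := by
  intro X hX Y hY h
  refine min_injOn_parts π hX hY (le_antisymm ?_ ?_)
  · exact not_lt.1 fun h' => h.not_gt ((blockIndex_lt_iff π hX).2 h')
  · exact not_lt.1 fun h' => h.not_lt ((blockIndex_lt_iff π hY).2 h')

/-- The blocks that overlap `X` and have a smaller least element all reach past the least element
of `X`, hence overlap one another. -/
theorem overlap_of_overlap {X Y Z : Finset (Fin n)} (hX : X ∈ π.parts) (hY : Y ∈ π.parts)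
    (hZ : Z ∈ π.parts) (hYX : blockIndex π Y < blockIndex π X)
    (hZX : blockIndex π Z < blockIndex π X) (hoY : Overlap Y X) (hoZ : Overlap Z X) :
    Overlap Y Z := by
  have key : ∀ Y Z, Y ∈ π.parts → Z ∈ π.parts → blockIndex π Z < blockIndex π X →
      Overlap Y X → ¬ BlockLT Y Z := by
    intro Y Z hY hZ hZX ho h
    obtain ⟨c, hc, hcX⟩ := (min_lt_min_iff (π.nonempty_of_mem_parts hX)
      (π.nonempty_of_mem_parts hZ)).1 ((blockIndex_lt_iff π hX).1 hZX)
    exact ho.1 fun a ha d hd => (h a ha c hc).trans (hcX d hd)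
  exact ⟨key Y Z hY hZ hZX hoY, key Z Y hZ hY hYX hoZ⟩

/-- The relation `BlockLT` on the blocks of `π`. -/
def blockBelow (X Y : π.parts) : Prop := BlockLT X.1 Y.1

theorem blockBelow_trans (X Y Z : π.parts) :
    blockBelow π X Y → blockBelow π Y Z → blockBelow π X Z :=
  BlockLT.trans (π.nonempty_of_mem_parts Y.2)

theorem not_blockBelow_self (X : π.parts) : ¬ blockBelow π X X :=
  not_blockLT_self (π.nonempty_of_mem_parts X.2)

theorem Overlap.symm {X Y : Finset (Fin n)} (h : Overlap X Y) : Overlap Y X := ⟨h.2, h.1⟩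

open Finset in
/-- The overlap graph is colored greedily in the order of the least elements of the blocks. The
hypothesis on the lists leaves room for a smaller list at the first block. -/
theorem card_separating (L : π.parts → Finset ℤ)
    (hL : ∀ X Y : π.parts, blockIndex π Y < blockIndex π X → L Y ⊆ L X) :
    (Nat.card {f : π.parts → ℤ // SeparatesIncomparable (blockBelow π) f ∧ ∀ X, f X ∈ L X} : ℤ) =
      ∏ X : π.parts, ((#(L X) : ℤ) - lowerDegree π X) := by
  classical
  have hrank : Function.Injective fun X : π.parts => blockIndex π X :=
    fun X Y h => Subtype.ext (blockIndex_injOn π X.2 Y.2 h)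
  have h := card_listColorings (fun X : π.parts => blockIndex π X) hrank
    (fun X Y => Overlap X.1 Y.1)
    (fun X Y Z hYZ hZX hY hZ => overlap_of_overlap π X.2 Y.2 Z.2 (hYZ.trans hZX) hZX hY hZ)
    L (fun X Y h _ => hL X Y h) univ
  simp only [mem_univ, if_true, forall_true_left] at h
  rw [Nat.subtype_card
    (p := fun f => SeparatesIncomparable (blockBelow π) f ∧ ∀ X, f X ∈ L X) _ ?_, h]
  · refine prod_congr rfl fun X _ => ?_
    congr 2
    rw [lowerDegree]
    refine card_nbij' (fun Y => Y.1) (fun Y => if h : Y ∈ π.parts then ⟨Y, h⟩ else X) ?_ ?_ ?_ ?_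
    · intro Y hY
      simp only [coe_filter, Set.mem_ofPred_eq, mem_univ, true_and] at hY ⊢
      exact ⟨Y.2, hY.1, hY.2.symm⟩
    · intro Y hY
      simp only [coe_filter, Set.mem_ofPred_eq, mem_univ, true_and] at hY ⊢
      simp only [hY.1, dif_pos]
      exact ⟨hY.2.1, hY.2.2.symm⟩
    · intro Y _
      simp
    · intro Y hY
      simp only [coe_filter, Set.mem_ofPred_eq] at hY
      simp [hY.1]
  · intro f
    simp only [mem_filter, Fintype.mem_piFinset]
    rw [and_comm]
    refine and_congr_left fun _ => ?_
    constructor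
    · intro hf X Y hne heq
      by_contra hn
      rw [not_or] at hn
      rcases lt_trichotomy (blockIndex π X) (blockIndex π Y) with h | h | h
      · exact hf X Y h ⟨hn.1, hn.2⟩ heq
      · exact hne (hrank h)
      · exact hf Y X h ⟨hn.2, hn.1⟩ heq.symm
    · intro hf Y Z hlt ho heq
      rcases hf Y Z (fun e => by simp [e] at hlt) heq with h | h
      · exact ho.1 h
      · exact ho.2 h

/-- The block of `π` that contains `v`. -/
def blockOf (v : Fin n) : π.parts := ⟨π.part v, π.part_mem.2 (Finset.mem_univ v)⟩

theorem mem_blockOf (v : Fin n) : v ∈ (blockOf π v).1 := π.mem_part (Finset.mem_univ v)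

theorem blockOf_eq_of_mem {v : Fin n} {X : π.parts} (h : v ∈ X.1) : blockOf π v = X :=
  Subtype.ext (π.part_eq_of_mem X.2 h)

theorem blockOf_surjective : Function.Surjective (blockOf π) := fun X =>
  let ⟨v, hv⟩ := π.nonempty_of_mem_parts X.2
  ⟨v, blockOf_eq_of_mem π hv⟩

/-! ### Proper colorations of the Linial graph by their color classes -/

theorem isProper_linialGraph_iff {A : Type} [AddGroupWithOne A] (κ : Fin n → A) :
    (linialGraph n).IsProper κ ↔ ∀ i j, i < j → κ j ≠ κ i + 1 := by
  constructor
  · intro h i j hij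
    simpa [linialGraph] using h ⟨(i, j), hij⟩
  · rintro h ⟨⟨i, j⟩, hij⟩
    simpa [linialGraph] using h i j hij

theorem isProper_comp_blockOf {g : π.parts → ℤ} :
    (linialGraph n).IsProper (fun v => g (blockOf π v)) ↔
      ∀ X Y, g Y = g X + 1 → blockBelow π Y X := by
  rw [isProper_linialGraph_iff]
  constructor
  · intro h X Y hXY c hc d hd
    by_contra hlt
    rcases (not_lt.1 hlt).lt_or_eq with hlt | rfl
    · have := h d c hlt
      rw [blockOf_eq_of_mem π hc, blockOf_eq_of_mem π hd] at this
      exact this hXY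
    · rw [← blockOf_eq_of_mem π hc, blockOf_eq_of_mem π hd] at hXY
      omega
  · intro h i j hij heq
    exact lt_asymm hij (h _ _ heq j (mem_blockOf π j) i (mem_blockOf π i))

/-- A coloration is a partition (into its color classes) with an injective coloring of the blocks.
`Ψ` is any further condition on the coloration. -/
theorem card_proper_eq_sum (Ψ : (Fin n → ℤ) → Prop)
    (hfin : ∀ π : Finpartition (Finset.univ : Finset (Fin n)),
      Finite {g : π.parts → ℤ // IsDescending (blockBelow π) g ∧ Ψ fun v => g (blockOf π v)}) :
    Nat.card {κ : Fin n → ℤ // Ψ κ ∧ (linialGraph n).IsProper κ} =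
      ∑ π : Finpartition (Finset.univ : Finset (Fin n)),
        Nat.card {g : π.parts → ℤ //
          IsDescending (blockBelow π) g ∧ Ψ fun v => g (blockOf π v)} := by
  classical
  rw [← Nat.card_sigma]
  symm
  refine Nat.card_eq_of_bijective (fun p => ⟨fun v => p.2.1 (blockOf p.1 v), p.2.2.2,
    (isProper_comp_blockOf p.1).2 p.2.2.1.2⟩) ⟨?_, ?_⟩
  · rintro ⟨π, g, hg⟩ ⟨π', g', hg'⟩ h
    simp only [Subtype.mk.injEq] at h
    have hpart : ∀ v, π.part v = π'.part v := by
      intro v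
      ext w
      have e1 := Subtype.ext_iff (a1 := blockOf π w) (a2 := blockOf π v)
      have e2 := Subtype.ext_iff (a1 := blockOf π' w) (a2 := blockOf π' v)
      rw [← hg.1.1.eq_iff, congrFun h w, congrFun h v, hg'.1.1.eq_iff] at e1
      rw [e2] at e1
      have m1 : w ∈ π.part v ↔ π.part w = π.part v :=
        π.mem_part_iff_part_eq_part (Finset.mem_univ _) (Finset.mem_univ _)
      have m2 : w ∈ π'.part v ↔ π'.part w = π'.part v :=
        π'.mem_part_iff_part_eq_part (Finset.mem_univ _) (Finset.mem_univ _)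
      rw [m1, m2]
      exact e1.symm
    have hπ : π = π' := by
      ext X
      constructor
      · intro hX
        obtain ⟨v, hv⟩ := blockOf_surjective π ⟨X, hX⟩
        have hv' : π.part v = X := Subtype.ext_iff.1 hv
        rw [← hv', hpart]
        exact (blockOf π' v).2
      · intro hX
        obtain ⟨v, hv⟩ := blockOf_surjective π' ⟨X, hX⟩
        have hv' : π'.part v = X := Subtype.ext_iff.1 hv
        rw [← hv', ← hpart]
        exact (blockOf π v).2
    subst hπ
    have : g = g' := by
      funext X
      obtain ⟨v, rfl⟩ := blockOf_surjective π X
      exact congrFun h v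
    subst this
    rfl
  · rintro ⟨κ, hΨ, hκ⟩
    let π := Finpartition.ofSetoid (Setoid.ker κ)
    have hiff : ∀ v w, blockOf π v = blockOf π w ↔ κ v = κ w := by
      intro v w
      rw [Subtype.ext_iff]
      have m1 : v ∈ π.part w ↔ π.part v = π.part w :=
        π.mem_part_iff_part_eq_part (Finset.mem_univ _) (Finset.mem_univ _)
      rw [show ((blockOf π v).1 = (blockOf π w).1) = (π.part v = π.part w) from rfl, ← m1,
        Finpartition.mem_part_ofSetoid_iff_rel]
      exact Setoid.ker_def.trans eq_comm
    let g : π.parts → ℤ := fun X => κ (Function.surjInv (blockOf_surjective π) X)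
    have hg : ∀ v, g (blockOf π v) = κ v := fun v =>
      (hiff _ _).1 (Function.surjInv_eq (blockOf_surjective π) _)
    have hg' : (fun v => g (blockOf π v)) = κ := funext hg
    refine ⟨⟨π, g, ⟨?_, ?_⟩, ?_⟩, Subtype.ext hg'⟩
    · intro X Y hXY
      obtain ⟨v, rfl⟩ := blockOf_surjective π X
      obtain ⟨w, rfl⟩ := blockOf_surjective π Y
      rw [hg, hg] at hXY
      exact (hiff _ _).2 hXY
    · exact (isProper_comp_blockOf π).1 (by rw [hg']; exact hκ)
    · rw [hg']; exact hΨ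

end Blocks

theorem card_descending_eq {α : Type*} [Fintype α] {r : α → α → Prop}
    (htrans : ∀ x y z, r x y → r y z → r x z) (hirr : ∀ x, ¬ r x x) {Ψ Θ : (α → ℤ) → Prop}
    (h : ∀ g, IsDescending r g → (Ψ g ↔ Θ (gapIndex g))) :
    Nat.card {g : α → ℤ // IsDescending r g ∧ Ψ g} =
      Nat.card {f : α → ℤ // SeparatesIncomparable r f ∧ Θ f} :=
  Nat.card_congr <| (Equiv.subtypeSubtypeEquivSubtypeInter _ Ψ).symm.trans <|
    ((gapEquiv htrans hirr).subtypeEquiv fun g => h g.1 g.2).trans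
      (Equiv.subtypeSubtypeEquivSubtypeInter _ Θ)

/-! ### The integral and modular chromatic functions -/

section Counting

variable {n : ℕ} (π : Finpartition (Finset.univ : Finset (Fin n)))

section First

variable (hn : 1 ≤ n)

theorem not_min_lt_first {Y : Finset (Fin n)} (hY : Y ∈ π.parts) :
    ¬ Y.min < (blockOf π ⟨0, hn⟩).1.min := by
  rw [min_lt_min_iff (π.nonempty_of_mem_parts (blockOf π _).2) (π.nonempty_of_mem_parts hY)]
  rintro ⟨c, -, hc⟩
  have := hc _ (mem_blockOf π ⟨0, hn⟩)
  rw [Fin.lt_def] at this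
  exact Nat.not_lt_zero _ this

theorem laterBlocks_eq_erase : laterBlocks π = π.parts.erase (blockOf π ⟨0, hn⟩).1 := by
  have hfirst := (blockOf π ⟨0, hn⟩).2
  have hone : blockIndex π (blockOf π ⟨0, hn⟩).1 = 1 := by
    rw [blockIndex, Finset.card_eq_one]
    refine ⟨(blockOf π ⟨0, hn⟩).1, Finset.eq_singleton_iff_unique_mem.2
      ⟨Finset.mem_filter.2 ⟨hfirst, le_rfl⟩, fun Y hY => ?_⟩⟩
    rw [Finset.mem_filter] at hY
    exact min_injOn_parts π hY.1 hfirst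
      (le_antisymm hY.2 (not_lt.1 (not_min_lt_first π hn hY.1)))
  ext X
  rw [laterBlocks, Finset.mem_filter, Finset.mem_erase, and_comm]
  refine and_congr_left fun hX => ⟨?_, fun hne => ?_⟩
  · rintro h rfl
    omega
  · have hlt : (blockOf π ⟨0, hn⟩).1.min < X.min :=
      lt_of_le_of_ne (not_lt.1 (not_min_lt_first π hn hX))
        fun h => hne (min_injOn_parts π hX hfirst h.symm)
    have := (blockIndex_lt_iff π hX).2 hlt
    omega

theorem not_blockIndex_lt_first {Y : Finset (Fin n)} (hY : Y ∈ π.parts) :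
    ¬ blockIndex π Y < blockIndex π (blockOf π ⟨0, hn⟩).1 := by
  rw [blockIndex_lt_iff π (blockOf π ⟨0, hn⟩).2]
  exact not_min_lt_first π hn hY

theorem lowerDegree_first : lowerDegree π (blockOf π ⟨0, hn⟩).1 = 0 := by
  classical
  rw [lowerDegree, Finset.card_eq_zero, Finset.filter_eq_empty_iff]
  exact fun Y hY h => not_blockIndex_lt_first π hn hY h.1

theorem prod_parts_eq (F : Finset (Fin n) → ℤ) :
    ∏ X : π.parts, F X = F (blockOf π ⟨0, hn⟩).1 * ∏ X ∈ laterBlocks π, F X := by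
  rw [laterBlocks_eq_erase π hn, Finset.mul_prod_erase _ _ (blockOf π ⟨0, hn⟩).2]
  exact Finset.prod_coe_sort _ _

end First

theorem card_parts_le : π.parts.card ≤ n := by
  simpa using π.card_parts_le_card

theorem lowerDegree_eq_zero_of_card_parts (h : π.parts.card = n) (X : Finset (Fin n))
    (hX : X ∈ π.parts) : lowerDegree π X = 0 := by
  have hone : ∀ Y ∈ π.parts, 1 = Y.card := by
    rw [← Finset.sum_eq_sum_iff_of_le fun Y hY =>
      Finset.card_pos.2 (π.nonempty_of_mem_parts hY), π.sum_card_parts]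
    simp [h]
  classical
  rw [lowerDegree, Finset.card_eq_zero, Finset.filter_eq_empty_iff]
  rintro Y hY ⟨hlt, ho⟩
  obtain ⟨a, rfl⟩ := Finset.card_eq_one.1 (hone X hX).symm
  obtain ⟨b, rfl⟩ := Finset.card_eq_one.1 (hone Y hY).symm
  rcases lt_trichotomy a b with h' | rfl | h'
  · exact ho.1 (by simpa [BlockLT] using h')
  · exact lt_irrefl _ hlt
  · exact ho.2 (by simpa [BlockLT] using h')

theorem forall_blockOf_iff {p : π.parts → Prop} : (∀ v, p (blockOf π v)) ↔ ∀ X, p X :=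
  (blockOf_surjective π).forall.symm

theorem finite_bounded {α : Type*} [Finite α] (N : ℤ) {p : (α → ℤ) → Prop}
    (h : ∀ g, p g → ∀ x, g x ∈ Set.Icc 1 N) : Finite {g : α → ℤ // p g} := by
  classical
  have := Fintype.ofFinite α
  refine ((Set.finite_Icc (fun _ : α => (1 : ℤ)) fun _ => N).subset ?_).to_subtype
  exact fun g hg => ⟨fun x => (h g hg x).1, fun x => (h g hg x).2⟩

theorem integralChromatic_linialGraph (hn : 1 ≤ n) (q : ℕ) (hq : n - 1 ≤ q) :
    ((linialGraph n).integralChromatic q : ℤ) =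
      ∑ π : Finpartition (Finset.univ : Finset (Fin n)),
        ((q : ℤ) - (π.parts.card : ℤ) + 1) *
          ∏ B ∈ laterBlocks π, ((q : ℤ) - (π.parts.card : ℤ) + 1 - (lowerDegree π B : ℤ)) := by
  rw [IntGainGraph.integralChromatic, card_proper_eq_sum fun κ => ∀ v, κ v ∈ Set.Icc 1 (q : ℤ)]
  · push_cast
    refine Finset.sum_congr rfl fun π _ => ?_
    rw [card_descending_eq (blockBelow_trans π) (not_blockBelow_self π)
      (Θ := fun f => ∀ X, f X ∈ Finset.Icc 1 ((q : ℤ) - π.parts.card + 1)),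
      card_separating π (fun _ => Finset.Icc 1 ((q : ℤ) - π.parts.card + 1)) fun _ _ _ => subset_rfl]
    · have hk := card_parts_le π
      have hcard : (((Finset.Icc 1 ((q : ℤ) - π.parts.card + 1)).card : ℕ) : ℤ) =
          (q : ℤ) - π.parts.card + 1 := by
        rw [Int.card_Icc]
        omega
      rw [prod_parts_eq π hn fun X => ((Finset.Icc 1 ((q : ℤ) - π.parts.card + 1)).card : ℤ) -
        (lowerDegree π X : ℤ), hcard, lowerDegree_first π hn]
      simp
    · intro g hg
      rw [forall_blockOf_iff π (p := fun X => g X ∈ Set.Icc 1 (q : ℤ)),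
        mem_Icc_iff_gapIndex_mem_Icc hg.1, Fintype.card_coe]
      simp only [Finset.mem_Icc, Set.mem_Icc]
  · intro π
    exact finite_bounded q fun g hg => (forall_blockOf_iff π).1 hg.2

/-- Proper colorations with colors `1, …, q - 1` in which the least vertex has the largest
color. -/
theorem card_pinned (hn : 2 ≤ n) (q : ℕ) (hq : n ≤ q) :
    (Nat.card {κ : Fin n → ℤ // ((∀ v, κ v ∈ Set.Icc 1 ((q : ℤ) - 1)) ∧
      κ ⟨0, by omega⟩ = (q : ℤ) - 1) ∧ (linialGraph n).IsProper κ} : ℤ) =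
      ∑ π : Finpartition (Finset.univ : Finset (Fin n)),
        ∏ B ∈ laterBlocks π, ((q : ℤ) - (π.parts.card : ℤ) - (lowerDegree π B : ℤ)) := by
  classical
  have hn1 : 1 ≤ n := by omega
  rw [card_proper_eq_sum fun κ => (∀ v, κ v ∈ Set.Icc 1 ((q : ℤ) - 1)) ∧
      κ ⟨0, by omega⟩ = (q : ℤ) - 1]
  · push_cast
    refine Finset.sum_congr rfl fun π _ => ?_
    set X₀ := blockOf π ⟨0, hn1⟩ with hX₀
    set m : ℤ := (q : ℤ) - π.parts.card with hm
    have hk := card_parts_le π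
    rw [card_descending_eq (blockBelow_trans π) (not_blockBelow_self π)
      (Θ := fun f => ∀ X, f X ∈ (Finset.Icc 1 m).filter fun c => X = X₀ → c = m),
      card_separating π (fun X => (Finset.Icc 1 m).filter fun c => X = X₀ → c = m)]
    · -- If `m = 0`, then `n = q` and `π` consists of singletons; both sides vanish, the right one
      -- because of the factor `0` of any later block.
      rcases (show 0 ≤ m by omega).eq_or_lt with hm0 | hm0
      · have hkn : π.parts.card = n := by omega
        have hlater : (laterBlocks π).Nonempty := by
          rw [← Finset.card_pos, laterBlocks_eq_erase π hn1, Finset.card_erase_of_mem X₀.2]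
          omega
        obtain ⟨B, hB⟩ := hlater
        rw [Finset.prod_eq_zero (Finset.mem_univ X₀), Finset.prod_eq_zero hB]
        · rw [lowerDegree_eq_zero_of_card_parts π hkn B (Finset.mem_of_mem_filter B hB), ← hm0]
          simp
        · rw [hX₀, lowerDegree_first π hn1, ← hm0]
          simp
      · have hcard : ∀ X : π.parts, ((((Finset.Icc 1 m).filter fun c => X = X₀ → c = m).card : ℕ) :
            ℤ) = if X.1 = X₀.1 then 1 else m := by
          intro X
          by_cases hX : X = X₀
          · rw [hX]
            have : ((Finset.Icc 1 m).filter fun c => X₀ = X₀ → c = m) = {m} := by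
              ext c
              simp only [Finset.mem_filter, Finset.mem_Icc, forall_true_left, Finset.mem_singleton]
              omega
            rw [this]
            simp
          · have hX' : ¬ X.1 = X₀.1 := fun h => hX (Subtype.ext h)
            simp only [hX, hX', IsEmpty.forall_iff, Finset.filter_true, if_false, Int.card_Icc]
            omega
        simp only [hcard]
        rw [prod_parts_eq π hn1 fun X => (if X = X₀.1 then (1 : ℤ) else m) - (lowerDegree π X : ℤ),
          lowerDegree_first π hn1, if_pos rfl, Nat.cast_zero, sub_zero, one_mul]
        refine Finset.prod_congr rfl fun B hB => ?_
        rw [laterBlocks_eq_erase π hn1] at hB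
        rw [if_neg (Finset.ne_of_mem_erase hB)]
    · intro X Y hXY c hc
      rw [Finset.mem_filter] at hc ⊢
      refine ⟨hc.1, ?_⟩
      rintro rfl
      exact absurd hXY (not_blockIndex_lt_first π hn1 Y.2)
    · intro g hg
      rw [forall_blockOf_iff π (p := fun X => g X ∈ Set.Icc 1 ((q : ℤ) - 1))]
      have hmin : ∀ Y, ¬ blockBelow π Y X₀ := fun Y h => by
        have := h _ (π.nonempty_of_mem_parts Y.2).choose_spec _ (mem_blockOf π ⟨0, hn1⟩)
        rw [Fin.lt_def] at this
        exact Nat.not_lt_zero _ this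
      have hcard : (q : ℤ) - 1 - Fintype.card π.parts + 1 = m := by
        rw [Fintype.card_coe, hm]; ring
      have h1 := mem_Icc_iff_gapIndex_mem_Icc hg.1 ((q : ℤ) - 1)
      rw [hcard] at h1
      simp only [Finset.mem_filter, Finset.mem_Icc, forall_and, forall_eq]
      rw [← forall_and]
      constructor
      · rintro ⟨h2, h3⟩
        exact ⟨h1.1 h2, ((eq_top_iff_gapIndex_eq hg (blockBelow_trans π) hmin h2).1 h3).trans hcard⟩
      · rintro ⟨h2, h3⟩
        have h4 := h1.2 h2
        exact ⟨h4, (eq_top_iff_gapIndex_eq hg (blockBelow_trans π) hmin h4).2 (h3.trans hcard.symm)⟩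
  · intro π
    exact finite_bounded ((q : ℤ) - 1) fun g hg => (forall_blockOf_iff π).1 hg.2.1

/-- Translating a modular coloration so that the least vertex gets the color `-1` makes the color
`0` unused, so that the colors can be read in `{1, …, q - 1}`. -/
theorem modularChromatic_eq_mul (hn : 2 ≤ n) (q : ℕ) (hq : n ≤ q) :
    (linialGraph n).modularChromatic q = q * Nat.card {κ : Fin n → ℤ //
      ((∀ v, κ v ∈ Set.Icc 1 ((q : ℤ) - 1)) ∧ κ ⟨0, by omega⟩ = (q : ℤ) - 1) ∧
        (linialGraph n).IsProper κ} := by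
  have : NeZero q := ⟨by omega⟩
  have hq1 : Fact (1 < q) := ⟨by omega⟩
  rw [IntGainGraph.modularChromatic]
  refine Eq.symm (Eq.trans (congrArg (· * _) (Nat.card_zmod q).symm) ?_)
  refine (Nat.card_prod _ _).symm.trans ?_
  refine Nat.card_eq_of_bijective (fun p => ⟨fun v => p.1 + (p.2.1 v : ZMod q), ?_⟩) ⟨?_, ?_⟩
  · obtain ⟨c, κ, ⟨hκ, -⟩, hp⟩ := p
    rw [isProper_linialGraph_iff] at hp ⊢
    intro i j hij h
    refine hp i j hij ?_
    have h1 : ((κ j : ℤ) : ZMod q) = ((κ i + 1 : ℤ) : ZMod q) := by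
      push_cast
      rw [add_assoc] at h
      exact add_left_cancel h
    rw [ZMod.intCast_eq_intCast_iff_dvd_sub] at h1
    have h2 := Int.eq_zero_of_abs_lt_dvd h1 (by
      have := hκ i
      have := hκ j
      simp only [Set.mem_Icc] at *
      rw [abs_lt]; constructor <;> omega)
    omega
  · rintro ⟨c, κ, ⟨hκ, h0⟩, hp⟩ ⟨c', κ', ⟨hκ', h0'⟩, hp'⟩ h
    simp only [Subtype.mk.injEq] at h
    have hc := congrFun h ⟨0, by omega⟩
    simp only [h0, h0', add_left_inj] at hc
    subst hc
    simp only [Prod.mk.injEq, true_and, Subtype.mk.injEq]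
    funext v
    have h1 := add_left_cancel (congrFun h v)
    rw [ZMod.intCast_eq_intCast_iff_dvd_sub] at h1
    have h2 := Int.eq_zero_of_abs_lt_dvd h1 (by
      have := hκ v
      have := hκ' v
      simp only [Set.mem_Icc] at *
      rw [abs_lt]; constructor <;> omega)
    omega
  · rintro ⟨κ, hp⟩
    -- The color following that of the least vertex is unused.
    have hp' := (isProper_linialGraph_iff κ).1 hp
    set c : ZMod q := κ ⟨0, by omega⟩ + 1 with hc
    have hcast : ∀ v, (((κ v - c).val : ℤ) : ZMod q) = κ v - c := fun v => by simp
    have hne : ∀ v, (κ v - c).val ≠ 0 := by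
      intro v h
      rw [ZMod.val_eq_zero, sub_eq_zero, hc] at h
      by_cases hv : v = ⟨0, by omega⟩
      · rw [hv] at h
        simp at h
      · refine hp' ⟨0, by omega⟩ v ?_ h
        rw [Fin.lt_def]
        exact Nat.pos_of_ne_zero fun h0 => hv (Fin.ext h0)
    have hlt : ∀ v, (κ v - c).val < q := fun v => ZMod.val_lt _
    refine ⟨⟨c, fun v => ((κ v - c).val : ℤ), ⟨?_, ?_⟩, ?_⟩, ?_⟩
    · intro v
      have := hne v
      have := hlt v
      change 1 ≤ (((κ v - c).val : ℕ) : ℤ) ∧ (((κ v - c).val : ℕ) : ℤ) ≤ (q : ℤ) - 1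
      omega
    · have : κ ⟨0, by omega⟩ - c = -1 := by rw [hc]; ring
      change (((κ ⟨0, by omega⟩ - c).val : ℕ) : ℤ) = _
      rw [this, ZMod.neg_val, if_neg one_ne_zero, ZMod.val_one]
      omega
    · rw [isProper_linialGraph_iff]
      intro i j hij h
      have h1 := congrArg (Int.cast : ℤ → ZMod q) h
      rw [Int.cast_add, hcast, hcast, Int.cast_one] at h1
      exact hp' i j hij (by linear_combination h1)
    · refine Subtype.ext (funext fun v => ?_)
      simp only [hcast]
      ring

theorem modularChromatic_linialGraph (hn : 1 ≤ n) (q : ℕ) (hq : n ≤ q) :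
    ((linialGraph n).modularChromatic q : ℤ) =
      (q : ℤ) * ∑ π : Finpartition (Finset.univ : Finset (Fin n)),
        ∏ B ∈ laterBlocks π, ((q : ℤ) - (π.parts.card : ℤ) - (lowerDegree π B : ℤ)) := by
  rcases hn.lt_or_eq with hn2 | rfl
  · rw [modularChromatic_eq_mul hn2 q hq, Nat.cast_mul, card_pinned hn2 q hq]
  · have : NeZero q := ⟨by omega⟩
    have hlater : ∀ π : Finpartition (Finset.univ : Finset (Fin 1)), laterBlocks π = ∅ := by
      intro π
      rw [← Finset.card_eq_zero, laterBlocks_eq_erase π le_rfl,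
        Finset.card_erase_of_mem (blockOf π _).2]
      have := card_parts_le π
      omega
    have hall : ∀ κ : Fin 1 → ZMod q, (linialGraph 1).IsProper κ := fun κ => by
      rw [isProper_linialGraph_iff]
      intro i j hij
      omega
    have hatom : IsAtom (Finset.univ : Finset (Fin 1)) := by
      rw [Finset.isAtom_iff]
      exact ⟨0, rfl⟩
    let := hatom.uniqueFinpartition (P := ⊥)
    rw [IntGainGraph.modularChromatic, Nat.card_congr (Equiv.subtypeUnivEquiv hall)]
    simp [hlater]

end Counting

/-! ### Walks, balance and potentials -/

theorem List.exists_eq_append_of_not_nodup_map {α β : Type*} (f : α → β) {l : List α}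
    (h : ¬ (l.map f).Nodup) :
    ∃ l₁ a l₂ b l₃, l = l₁ ++ a :: (l₂ ++ b :: l₃) ∧ f a = f b := by
  induction l with
  | nil => simp at h
  | cons a l ih =>
    by_cases ha : f a ∈ l.map f
    · obtain ⟨b, hb, hab⟩ := List.mem_map.1 ha
      obtain ⟨l₂, l₃, rfl⟩ := List.append_of_mem hb
      exact ⟨[], a, l₂, b, l₃, rfl, hab.symm⟩
    · rw [List.map_cons, List.nodup_cons, not_and] at h
      obtain ⟨l₁, c, l₂, b, l₃, rfl, hcb⟩ := ih (h ha)
      exact ⟨a :: l₁, c, l₂, b, l₃, rfl, hcb⟩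

namespace IntGainGraph

variable {V E : Type} (Φ : IntGainGraph V E)

theorem isWalk_append {u w : V} {l₁ l₂ : List (E × Bool)} :
    Φ.IsWalk u (l₁ ++ l₂) w ↔ ∃ v, Φ.IsWalk u l₁ v ∧ Φ.IsWalk v l₂ w := by
  induction l₁ generalizing u with
  | nil => simp [IsWalk]
  | cons d l ih => simp [IsWalk, ih, and_assoc]

@[simp]
theorem walkGain_nil : Φ.walkGain [] = 0 := rfl

@[simp]
theorem walkGain_cons (d : E × Bool) (l : List (E × Bool)) :
    Φ.walkGain (d :: l) = Φ.orientedGain d + Φ.walkGain l := by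
  simp [walkGain]

@[simp]
theorem walkGain_append (l₁ l₂ : List (E × Bool)) :
    Φ.walkGain (l₁ ++ l₂) = Φ.walkGain l₁ + Φ.walkGain l₂ := by
  simp [walkGain]

/-- `κ` is a potential for the edge set `S`: its increment along each edge of `S` is the gain. As a
coloration, `κ` violates properness at every edge of `S`. -/
def IsPotential (S : Finset E) {A : Type} [AddGroupWithOne A] (κ : V → A) : Prop :=
  ∀ e ∈ S, κ (Φ.head e) = κ (Φ.tail e) + (Φ.gain e : A)

variable {Φ} in
theorem IsPotential.add_walkGain {S : Finset E} {A : Type} [AddGroupWithOne A] {κ : V → A}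
    (hκ : Φ.IsPotential S κ) {u v : V} {l : List (E × Bool)} (hl : Φ.IsWalk u l v)
    (hS : ∀ d ∈ l, d.1 ∈ S) : κ v = κ u + (Φ.walkGain l : A) := by
  induction l generalizing u with
  | nil => simp [show u = v from hl]
  | cons d l ih =>
    obtain ⟨rfl, hl⟩ := hl
    have hd := hκ d.1 (hS d (by simp))
    rw [ih hl fun d' hd' => hS d' (by simp [hd']), walkGain_cons, Int.cast_add, ← add_assoc]
    congr 1
    rcases d with ⟨e, _ | _⟩
    · simp only [tgt, src, orientedGain, Bool.false_eq_true, if_false] at hd ⊢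
      simp [hd]
    · simpa [tgt, src, orientedGain] using hd

/-- Every circle contained in `S` has gain `0`. -/
def IsBalancedSet (S : Finset E) : Prop :=
  ∀ (u : V) (l : List (E × Bool)), Φ.IsCircle u l → (∀ d ∈ l, d.1 ∈ S) → Φ.walkGain l = 0

theorem isBalancedSet_iff (S : Finset E) :
    Φ.IsBalancedSet S ↔ ∀ C, Φ.IsBalancedComponent S C :=
  ⟨fun h _ u l _ => h u l, fun h u l => h _ u l rfl⟩

variable {Φ} in
/-- A closed walk that is not a circle repeats a vertex or an edge. A repeated vertex splits it
into two shorter closed walks. An edge repeated in the opposite direction contributes nothing, and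
without it two shorter closed walks are left. -/
theorem IsBalancedSet.walkGain_eq_zero {S : Finset E} (hS : Φ.IsBalancedSet S) {u : V}
    {l : List (E × Bool)} (hl : Φ.IsWalk u l u) (hlS : ∀ d ∈ l, d.1 ∈ S) : Φ.walkGain l = 0 := by
  induction hlen : l.length using Nat.strong_induction_on generalizing u l with
  | _ k ih =>
    subst hlen
    have key : ∀ l₁ a l₂ b l₃, l = l₁ ++ a :: (l₂ ++ b :: l₃) → Φ.src a = Φ.src b →
        Φ.walkGain l = 0 := by
      rintro l₁ a l₂ b l₃ rfl hab
      simp only [isWalk_append, IsWalk] at hl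
      obtain ⟨v, h₁, rfl, w, h₂, rfl, h₃⟩ := hl
      have g₁ := ih (a :: l₂).length (by simp; omega) (u := Φ.src a) (l := a :: l₂)
        ⟨rfl, hab ▸ h₂⟩ (fun d hd => hlS d (by simp at hd ⊢; tauto)) rfl
      have g₂ := ih (l₁ ++ b :: l₃).length (by simp) (u := u) (l := l₁ ++ b :: l₃)
        ((Φ.isWalk_append).2 ⟨_, h₁, hab.symm, h₃⟩)
        (fun d hd => hlS d (by simp at hd ⊢; tauto)) rfl
      simp only [walkGain_append, walkGain_cons] at g₁ g₂ ⊢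
      linarith
    by_cases hsrc : (l.map Φ.src).Nodup
    swap
    · obtain ⟨l₁, a, l₂, b, l₃, h, hab⟩ := List.exists_eq_append_of_not_nodup_map _ hsrc
      exact key l₁ a l₂ b l₃ h hab
    by_cases hedge : (l.map Prod.fst).Nodup
    swap
    · obtain ⟨l₁, a, l₂, b, l₃, h, hab⟩ := List.exists_eq_append_of_not_nodup_map _ hedge
      by_cases hdir : a = b
      · exact key l₁ a l₂ b l₃ h (by rw [hdir])
      have hrev : Φ.src b = Φ.tgt a ∧ Φ.tgt b = Φ.src a ∧
          Φ.orientedGain b = -Φ.orientedGain a := by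
        rcases a with ⟨e, _ | _⟩ <;> rcases b with ⟨e', _ | _⟩ <;>
          simp_all [src, tgt, orientedGain]
      subst h
      simp only [isWalk_append, IsWalk] at hl
      obtain ⟨v, h₁, rfl, w, h₂, rfl, h₃⟩ := hl
      rw [hrev.1] at h₂
      rw [hrev.2.1] at h₃
      have g₁ := ih l₂.length (by simp; omega) h₂
        (fun d hd => hlS d (by simp [hd])) rfl
      have g₂ := ih (l₁ ++ l₃).length (by simp; omega) (u := u) (l := l₁ ++ l₃)
        ((Φ.isWalk_append).2 ⟨_, h₁, h₃⟩)
        (fun d hd => hlS d (by simp at hd ⊢; tauto)) rfl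
      simp only [walkGain_append, walkGain_cons, hrev.2.2] at g₁ g₂ ⊢
      linarith
    by_cases hnil : l = []
    · simp [hnil]
    · exact hS u l ⟨hnil, hl, hedge, hsrc⟩ hlS

/-- Connected vertices are joined by walks. Both directions are proved at once, which gives the
symmetry step of the generated equivalence relation without reversing walks. -/
theorem exists_isWalk_of_connectivity {S : Finset E} {u v : V} (h : Φ.connectivity S u v) :
    (∃ l, Φ.IsWalk u l v ∧ ∀ d ∈ l, d.1 ∈ S) ∧ ∃ l, Φ.IsWalk v l u ∧ ∀ d ∈ l, d.1 ∈ S := by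
  induction (show Relation.EqvGen _ u v from h) with
  | rel x y hxy =>
    obtain ⟨e, he, rfl, rfl⟩ := hxy
    exact ⟨⟨[(e, true)], by simp [IsWalk, src, tgt], by simpa using he⟩,
      ⟨[(e, false)], by simp [IsWalk, src, tgt], by simpa using he⟩⟩
  | refl x => exact ⟨⟨[], rfl, by simp⟩, ⟨[], rfl, by simp⟩⟩
  | symm x y hxy ih => exact (ih hxy).symm
  | trans x y z hxy hyz ih₁ ih₂ =>
    have trans : ∀ a b c, (∃ l, Φ.IsWalk a l b ∧ ∀ d ∈ l, d.1 ∈ S) →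
        (∃ l, Φ.IsWalk b l c ∧ ∀ d ∈ l, d.1 ∈ S) → ∃ l, Φ.IsWalk a l c ∧ ∀ d ∈ l, d.1 ∈ S := by
      rintro a b c ⟨l, hl, hlS⟩ ⟨l', hl', hlS'⟩
      refine ⟨l ++ l', (Φ.isWalk_append).2 ⟨b, hl, hl'⟩, fun d hd => ?_⟩
      rcases List.mem_append.1 hd with hd | hd
      · exact hlS d hd
      · exact hlS' d hd
    exact ⟨trans _ _ _ (ih₁ hxy).1 (ih₂ hyz).1, trans _ _ _ (ih₂ hyz).2 (ih₁ hxy).2⟩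

theorem connectivity_of_mem {S : Finset E} {e : E} (he : e ∈ S) :
    Φ.connectivity S (Φ.tail e) (Φ.head e) :=
  Relation.EqvGen.rel _ _ ⟨e, he, rfl, rfl⟩

variable {Φ} in
/-- The potential of a vertex is the gain of a chosen walk to it from a root of its component. -/
theorem IsBalancedSet.exists_isPotential {S : Finset E} (hS : Φ.IsBalancedSet S) :
    ∃ p : V → ℤ, Φ.IsPotential S p := by
  have hex : ∀ v, Φ.connectivity S (Quotient.mk (Φ.connectivity S) v).out v := fun v =>
    Quotient.mk_out (s := Φ.connectivity S) v
  choose w hw hwS using fun v => (Φ.exists_isWalk_of_connectivity (hex v)).1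
  refine ⟨fun v => Φ.walkGain (w v), fun e he => ?_⟩
  have hroot : (Quotient.mk (Φ.connectivity S) (Φ.tail e)) =
      Quotient.mk (Φ.connectivity S) (Φ.head e) := Quotient.sound (Φ.connectivity_of_mem he)
  obtain ⟨l, hl, hlS⟩ := (Φ.exists_isWalk_of_connectivity (hex (Φ.head e))).2
  -- Compare the closed walks through `head e` that use, or do not use, the edge `e`.
  have g₁ := hS.walkGain_eq_zero (l := w (Φ.head e) ++ l)
    ((Φ.isWalk_append).2 ⟨_, hw _, hl⟩) (fun d hd => by
      rcases List.mem_append.1 hd with hd | hd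
      · exact hwS _ d hd
      · exact hlS d hd)
  have htail := hw (Φ.tail e)
  rw [hroot] at htail
  have g₂ := hS.walkGain_eq_zero (l := w (Φ.tail e) ++ (e, true) :: l)
    ((Φ.isWalk_append).2 ⟨_, htail, by simp [src], by simpa [tgt] using hl⟩) (fun d hd => by
      rcases List.mem_append.1 hd with hd | hd
      · exact hwS _ d hd
      · rcases List.mem_cons.1 hd with rfl | hd
        · exact he
        · exact hlS d hd)
  simp only [walkGain_append, walkGain_cons, orientedGain, if_true] at g₁ g₂
  simp only [Int.cast_id]
  linarith

variable {Φ} in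
theorem IsPotential.intCast {S : Finset E} {p : V → ℤ} (hp : Φ.IsPotential S p) (A : Type)
    [AddGroupWithOne A] : Φ.IsPotential S fun v => (p v : A) := fun e he => by
  have := congrArg (Int.cast : ℤ → A) (hp e he)
  simpa using this

theorem eq_of_connectivity {S : Finset E} {A : Type*} {h : V → A}
    (hh : ∀ e ∈ S, h (Φ.head e) = h (Φ.tail e)) {u v : V} (huv : Φ.connectivity S u v) :
    h u = h v := by
  have : Φ.connectivity S ≤ Setoid.ker h := Setoid.eqvGen_le fun x y ⟨e, he, hx, hy⟩ => by
    subst hx hy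
    exact (hh e he).symm
  exact this huv

/-- Given one potential `p`, the others differ from it by a constant on each component. -/
def potentialEquiv {S : Finset E} {A : Type} [AddCommGroupWithOne A] {p : V → A}
    (hp : Φ.IsPotential S p) :
    {κ : V → A // Φ.IsPotential S κ} ≃ (Φ.Component S → A) where
  toFun κ := Quotient.lift (fun v => κ.1 v - p v) fun u v huv =>
    Φ.eq_of_connectivity (h := fun v => κ.1 v - p v)
      (fun e he => by simp only [κ.2 e he, hp e he]; abel) huv
  invFun h := ⟨fun v => p v + h (Quotient.mk _ v), fun e he => by
    simp only [hp e he, Quotient.sound (Φ.connectivity_of_mem he)]; abel⟩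
  left_inv κ := by ext v; simp
  right_inv h := by
    funext C
    induction C using Quotient.inductionOn with
    | _ v => simp

/-! ### The zero-free chromatic polynomial -/

variable [Fintype E]

theorem abs_walkGain_le {l : List (E × Bool)} (hl : (l.map Prod.fst).Nodup) :
    |Φ.walkGain l| ≤ ∑ e, |Φ.gain e| := by
  classical
  have h1 : |Φ.walkGain l| ≤ ((l.map Prod.fst).map fun e => |Φ.gain e|).sum := by
    clear hl
    induction l with
    | nil => simp
    | cons d l ih =>
      rw [walkGain_cons, List.map_cons, List.map_cons, List.sum_cons]
      refine (abs_add_le _ _).trans (add_le_add ?_ ih)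
      rcases d with ⟨e, _ | _⟩ <;> simp [orientedGain]
  rw [← List.sum_toFinset _ hl] at h1
  exact h1.trans (Finset.sum_le_sum_of_subset_of_nonneg (Finset.subset_univ _)
    fun _ _ _ => abs_nonneg _)

open scoped Classical in
theorem card_isPotential_zmod [Finite V] (S : Finset E) {q : ℕ} (hq : ∑ e, |Φ.gain e| < q) :
    Nat.card {κ : V → ZMod q // Φ.IsPotential S κ} =
      if Φ.IsBalancedSet S then q ^ Φ.numComponents S else 0 := by
  split_ifs with hS
  · obtain ⟨p, hp⟩ := hS.exists_isPotential
    rw [Nat.card_congr (Φ.potentialEquiv (hp.intCast (ZMod q))), Nat.card_fun, Nat.card_zmod,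
      numComponents]
  · rw [Nat.card_eq_zero]
    left
    refine ⟨fun κ => hS fun u l hl hlS => ?_⟩
    have h := κ.2.add_walkGain hl.2.1 hlS
    rw [left_eq_add, ZMod.intCast_zmod_eq_zero_iff_dvd] at h
    exact Int.eq_zero_of_abs_lt_dvd h ((Φ.abs_walkGain_le hl.2.2.1).trans_lt hq)

open Polynomial in
open scoped Classical in
theorem zeroFreeChromatic_eq [Finite V] :
    Φ.zeroFreeChromatic = ∑ S : Finset E,
      if Φ.IsBalancedSet S then (-1 : ℤ[X]) ^ S.card * X ^ Φ.numComponents S else 0 := by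
  rw [zeroFreeChromatic, totalChromatic, eval_finsetSum]
  refine Finset.sum_congr rfl fun S _ => ?_
  simp only [eval_mul, eval_pow, eval_neg, eval_one, eval_C, eval_X]
  split_ifs with hS
  · have : Φ.numBalanced S = Φ.numComponents S :=
      Nat.card_congr (Equiv.subtypeUnivEquiv ((Φ.isBalancedSet_iff S).1 hS))
    simp [this]
  · rw [isBalancedSet_iff, not_forall] at hS
    obtain ⟨C, hC⟩ := hS
    have : Φ.numBalanced S < Φ.numComponents S := Finite.card_subtype_lt hC
    rw [zero_pow (by omega), mul_zero]

open scoped Classical in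
theorem modularChromatic_eq_sum [Finite V] (q : ℕ) [NeZero q] :
    (Φ.modularChromatic q : ℤ) = ∑ S : Finset E,
      (-1) ^ S.card * (Nat.card {κ : V → ZMod q // Φ.IsPotential S κ} : ℤ) := by
  have := Fintype.ofFinite V
  have h := Finset.inclusion_exclusion_card_inf_compl (Finset.univ : Finset E) fun e =>
    (Finset.univ.filter fun κ : V → ZMod q => κ (Φ.head e) = κ (Φ.tail e) + (Φ.gain e : ZMod q))
  rw [Finset.powerset_univ] at h
  rw [modularChromatic, Nat.subtype_card (p := fun κ => Φ.IsProper κ) _ ?_, h]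
  · refine Finset.sum_congr rfl fun S _ => ?_
    rw [Nat.subtype_card (p := fun κ => Φ.IsPotential S κ)]
    intro κ
    simp [Finset.mem_inf, IsPotential]
  · intro κ
    simp [Finset.mem_inf, IsProper]

/-- If `q` exceeds the absolute gain of every circle, then balance modulo `q` is balance. -/
theorem eval_zeroFreeChromatic [Finite V] {q : ℕ} (hq : ∑ e, |Φ.gain e| < q) :
    Φ.zeroFreeChromatic.eval (q : ℤ) = Φ.modularChromatic q := by
  classical
  have hpos : 0 < q := by
    exact_mod_cast (Finset.sum_nonneg fun e _ => abs_nonneg (Φ.gain e)).trans_lt hq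
  have : NeZero q := ⟨hpos.ne'⟩
  rw [zeroFreeChromatic_eq, Polynomial.eval_finsetSum, modularChromatic_eq_sum]
  refine Finset.sum_congr rfl fun S _ => ?_
  rw [Φ.card_isPotential_zmod S hq]
  split_ifs <;> simp

end IntGainGraph

open Polynomial in
theorem zeroFreeChromatic_linialGraph {n : ℕ} (hn : 1 ≤ n) :
    (linialGraph n).zeroFreeChromatic =
      (X : ℤ[X]) * ∑ π : Finpartition (Finset.univ : Finset (Fin n)),
        ∏ B ∈ laterBlocks π, ((X : ℤ[X]) - (π.parts.card : ℤ[X]) - (lowerDegree π B : ℤ[X])) := by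
  refine eq_of_infinite_eval_eq _ _ (Set.infinite_of_injective_forall_mem
    (f := fun k : ℕ => ((n + (∑ e, |(linialGraph n).gain e|).toNat + 1 + k : ℕ) : ℤ)) ?_ ?_)
  · intro a b h
    simpa using h
  · intro k
    rw [Set.mem_ofPred_eq, IntGainGraph.eval_zeroFreeChromatic _ (by omega),
      modularChromatic_linialGraph hn _ (by omega)]
    simp [eval_finsetSum, eval_prod]

/-! ### Whitney's theorem for affine arrangements -/

section Whitney

variable {W : Type} [AddCommGroup W] [Module ℝ W] {A : Finset (AffineSubspace ℝ W)}

open scoped Classical in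
/-- The signed sum over the sets of hyperplanes that intersect in a given flat satisfies the
recursion of the Möbius function: summed over all flats containing `F`, it runs over all sets of
hyperplanes containing `F`. -/
theorem sum_Icc_whole_eq (hA : ∀ H ∈ A, H ≠ ⊤) (F : IntersectionPoset A) :
    ∑ G ∈ Finset.Icc (IntersectionPoset.whole A) F,
      ∑ B ∈ A.powerset.filter fun B : Finset (AffineSubspace ℝ W) =>
        sInf (B : Set (AffineSubspace ℝ W)) = G.1, (-1 : ℤ) ^ B.card =
      if IntersectionPoset.whole A = F then 1 else 0 := by
  have hempty : (A.filter fun H => F.1 ≤ H) = ∅ ↔ IntersectionPoset.whole A = F := by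
    rw [Finset.filter_eq_empty_iff]
    constructor
    · intro h
      obtain ⟨B, hB, hF⟩ := F.2.2
      have hB0 : B = ∅ := by
        rw [Finset.eq_empty_iff_forall_notMem]
        intro H hH
        exact h (hB hH) (hF ▸ sInf_le (Finset.mem_coe.2 hH))
      refine Subtype.ext ?_
      rw [hF, hB0]
      simp [IntersectionPoset.whole]
    · rintro rfl H hH hle
      exact hA H hH (top_le_iff.1 hle)
  rw [← if_congr hempty rfl rfl, ← Finset.sum_powerset_neg_one_pow_card,
    ← Finset.sum_biUnion]
  · refine Finset.sum_congr ?_ fun _ _ => rfl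
    ext B
    simp only [Finset.mem_biUnion, Finset.mem_Icc, Finset.mem_filter, Finset.mem_powerset]
    constructor
    · rintro ⟨G, ⟨-, hGF⟩, hB, hG⟩ H hH
      refine Finset.mem_filter.2 ⟨hB hH, ?_⟩
      have hle : F.1 ≤ G.1 := hGF
      exact hle.trans (hG ▸ sInf_le (Finset.mem_coe.2 hH))
    · intro hB
      have hle : F.1 ≤ sInf (B : Set (AffineSubspace ℝ W)) :=
        le_sInf fun H hH => (Finset.mem_filter.1 (hB hH)).2
      have hBA : B ⊆ A := hB.trans (Finset.filter_subset _ _)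
      exact ⟨⟨sInf B, fun h => F.2.1 (le_bot_iff.1 (hle.trans_eq h)), B, hBA, rfl⟩,
        ⟨show _ ≤ (⊤ : AffineSubspace ℝ W) from le_top, hle⟩, hBA, rfl⟩
  · intro G _ G' _ hne
    rw [Function.onFun, Finset.disjoint_left]
    intro B hB hB'
    exact hne (Subtype.ext ((Finset.mem_filter.1 hB).2.symm.trans (Finset.mem_filter.1 hB').2))

open scoped Classical in
theorem mu_whole_eq (hA : ∀ H ∈ A, H ≠ ⊤) (F : IntersectionPoset A) :
    IncidenceAlgebra.mu ℤ (IntersectionPoset.whole A) F =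
      ∑ B ∈ A.powerset.filter fun B : Finset (AffineSubspace ℝ W) =>
        sInf (B : Set (AffineSubspace ℝ W)) = F.1,
        (-1 : ℤ) ^ B.card := by
  induction F using WellFoundedLT.induction with
  | _ F ih =>
    have hle : IntersectionPoset.whole A ≤ F := show F.1 ≤ ⊤ from le_top
    have h1 := sum_Icc_whole_eq hA F
    rw [← IncidenceAlgebra.sum_Icc_mu_right, ← Finset.Ico_insert_right hle,
      Finset.sum_insert Finset.right_notMem_Ico, Finset.sum_insert Finset.right_notMem_Ico,
      Finset.sum_congr rfl fun G hG => (ih G (Finset.mem_Ico.1 hG).2)] at h1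
    exact (add_right_cancel h1).symm

open Polynomial in
open scoped Classical in
/-- Whitney's theorem: the characteristic polynomial as a sum over subarrangements with nonempty
intersection. -/
theorem arrangementCharpoly_eq_sum (hA : ∀ H ∈ A, H ≠ ⊤) :
    arrangementCharpoly A = ∑ B ∈ A.powerset,
      if sInf (B : Set (AffineSubspace ℝ W)) = ⊥ then 0 else
        (-1 : ℤ[X]) ^ B.card *
          X ^ Module.finrank ℝ (sInf (B : Set (AffineSubspace ℝ W))).direction := by
  rw [arrangementCharpoly]
  simp only [mu_whole_eq hA, Finset.sum_filter, map_sum, Finset.sum_mul]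
  rw [Finset.sum_comm]
  refine Finset.sum_congr rfl fun B hB => ?_
  split_ifs with h
  · refine Finset.sum_eq_zero fun F _ => ?_
    have hne : ¬ sInf (B : Set (AffineSubspace ℝ W)) = F.1 := fun h' => F.2.1 (h'.symm.trans h)
    simp [hne]
  · obtain ⟨F₀, hF₀⟩ : ∃ F : IntersectionPoset A, sInf (B : Set (AffineSubspace ℝ W)) = F.1 :=
      ⟨⟨sInf B, h, B, Finset.mem_powerset.1 hB, rfl⟩, rfl⟩
    refine (Finset.sum_eq_single F₀ (fun F _ hF => ?_) (by simp)).trans ?_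
    · have hne : ¬ sInf (B : Set (AffineSubspace ℝ W)) = F.1 := fun h' =>
        hF (Subtype.ext (h'.symm.trans hF₀))
      simp [hne]
    · rw [if_pos hF₀, ← hF₀]
      simp

end Whitney

/-! ### The affinographic arrangement of a gain graph -/

namespace IntGainGraph

variable {V E : Type} (Φ : IntGainGraph V E)

/-- The hyperplane `x_j = x_i + g` of an edge from `i` to `j` with gain `g`. -/
def edgeHyperplane (e : E) : AffineSubspace ℝ (V → ℝ) :=
  affinographicHyperplane (Φ.tail e) (Φ.head e) (Φ.gain e : ℝ)

theorem mem_edgeHyperplane {e : E} {x : V → ℝ} :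
    x ∈ Φ.edgeHyperplane e ↔ x (Φ.head e) = x (Φ.tail e) + Φ.gain e :=
  Iff.rfl

theorem edgeHyperplane_ne_top {e : E} (he : Φ.tail e ≠ Φ.head e) : Φ.edgeHyperplane e ≠ ⊤ := by
  classical
  intro h
  have hmem : (Function.update 0 (Φ.head e) (Φ.gain e + 1 : ℝ) : V → ℝ) ∈ Φ.edgeHyperplane e :=
    h ▸ AffineSubspace.mem_top ℝ _ _
  rw [mem_edgeHyperplane, Function.update_self, Function.update_of_ne he] at hmem
  simp at hmem

open scoped Classical in
theorem mem_sInf_image {S : Finset E} {x : V → ℝ} :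
    x ∈ sInf ((S.image Φ.edgeHyperplane : Finset _) : Set (AffineSubspace ℝ (V → ℝ))) ↔
      Φ.IsPotential S x := by
  rw [← SetLike.mem_coe, AffineSubspace.coe_sInf]
  simp [IsPotential, mem_edgeHyperplane]

open scoped Classical in
theorem sInf_image_eq_bot_iff {S : Finset E} :
    sInf ((S.image Φ.edgeHyperplane : Finset _) : Set (AffineSubspace ℝ (V → ℝ))) = ⊥ ↔
      ¬ Φ.IsBalancedSet S := by
  rw [← not_iff_not, not_not, ← ne_eq, ← AffineSubspace.nonempty_iff_ne_bot]
  constructor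
  · rintro ⟨x, hx⟩ u l hl hlS
    have h := (Φ.mem_sInf_image.1 hx).add_walkGain hl.2.1 hlS
    rw [left_eq_add] at h
    exact_mod_cast h
  · intro h
    obtain ⟨p, hp⟩ := h.exists_isPotential
    exact ⟨_, Φ.mem_sInf_image.2 (hp.intCast ℝ)⟩

open scoped Classical in
theorem finrank_direction_sInf_image [Finite V] {S : Finset E} (hS : Φ.IsBalancedSet S) :
    Module.finrank ℝ (sInf ((S.image Φ.edgeHyperplane : Finset _) :
      Set (AffineSubspace ℝ (V → ℝ)))).direction = Φ.numComponents S := by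
  obtain ⟨p, hp⟩ := hS.exists_isPotential
  have hp' := hp.intCast ℝ
  have hrange : (sInf ((S.image Φ.edgeHyperplane : Finset _) :
      Set (AffineSubspace ℝ (V → ℝ)))).direction =
      LinearMap.range (LinearMap.funLeft ℝ ℝ (Quotient.mk (Φ.connectivity S))) := by
    ext v
    rw [← AffineSubspace.vadd_mem_iff_mem_direction v (Φ.mem_sInf_image.2 hp'), mem_sInf_image,
      LinearMap.mem_range]
    constructor
    · intro h
      refine ⟨Quotient.lift v fun a b hab => Φ.eq_of_connectivity (fun e he => ?_) hab, ?_⟩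
      · have h1 := h e he
        have h2 := hp' e he
        simp only [vadd_eq_add, Pi.add_apply] at h1
        linarith
      · ext u
        rfl
    · rintro ⟨h, rfl⟩ e he
      have h2 := hp' e he
      simp only [vadd_eq_add, Pi.add_apply, LinearMap.funLeft_apply,
        Quotient.sound (Φ.connectivity_of_mem he)]
      linarith
  have := Fintype.ofFinite (Φ.Component S)
  rw [hrange, LinearMap.finrank_range_of_inj
    (LinearMap.funLeft_injective_of_surjective ℝ ℝ _ Quotient.mk_surjective),
    Module.finrank_fintype_fun_eq_card, numComponents, Nat.card_eq_fintype_card]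

theorem arrangementCharpoly_arrangement [Finite V] [Fintype E]
    (hloop : ∀ e, Φ.tail e ≠ Φ.head e) (hinj : Function.Injective Φ.edgeHyperplane) :
    arrangementCharpoly Φ.arrangement = Φ.zeroFreeChromatic := by
  classical
  have harr : Φ.arrangement = Finset.univ.image Φ.edgeHyperplane := by
    rw [arrangement, Finset.filter_true_of_mem fun e _ => hloop e]
    rfl
  rw [harr, arrangementCharpoly_eq_sum, zeroFreeChromatic_eq, Finset.powerset_image,
    Finset.sum_image fun S _ T _ h => Finset.image_injective hinj h, Finset.powerset_univ]
  · refine Finset.sum_congr rfl fun S _ => ?_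
    by_cases hS : Φ.IsBalancedSet S
    · rw [if_neg (by rw [sInf_image_eq_bot_iff, not_not]; exact hS), if_pos hS,
        finrank_direction_sInf_image Φ hS, Finset.card_image_of_injective _ hinj]
    · rw [if_pos (Φ.sInf_image_eq_bot_iff.2 hS), if_neg hS]
  · intro H hH
    obtain ⟨e, -, rfl⟩ := Finset.mem_image.1 hH
    exact Φ.edgeHyperplane_ne_top (hloop e)

end IntGainGraph

theorem edgeHyperplane_linialGraph_injective (n : ℕ) :
    Function.Injective (linialGraph n).edgeHyperplane := by
  rintro ⟨⟨i, j⟩, hij : i < j⟩ ⟨⟨i', j'⟩, hij' : i' < j'⟩ h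
  have key : ∀ x : Fin n → ℝ, x j = x i + 1 → x j' = x i' + 1 := by
    intro x hx
    have h1 : x ∈ (linialGraph n).edgeHyperplane ⟨(i, j), hij⟩ := by
      rw [IntGainGraph.mem_edgeHyperplane]
      simpa [linialGraph] using hx
    rw [h, IntGainGraph.mem_edgeHyperplane] at h1
    simpa [linialGraph] using h1
  -- The unit vector at `j` and its negative at `i` lie on the hyperplane of `(i, j)` and detect
  -- its ends.
  have hj := key (Pi.single j 1) (by simp [hij.ne])
  have hi := key (Pi.single i (-1)) (by simp [hij.ne'])
  have hjj : j' = j := by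
    by_contra hne
    rw [Pi.single_eq_of_ne hne] at hj
    by_cases h' : i' = j
    · subst h'; norm_num at hj
    · rw [Pi.single_eq_of_ne h'] at hj; norm_num at hj
  have hii : i' = i := by
    by_contra hne
    rw [Pi.single_eq_of_ne hne] at hi
    by_cases h' : j' = i
    · subst h'; norm_num at hi
    · rw [Pi.single_eq_of_ne h'] at hi; norm_num at hi
  subst hjj hii
  rfl

open Polynomial in
theorem theorem9p2 (n : ℕ) (hn : 1 ≤ n) :
    (∀ q : ℕ, n - 1 ≤ q →
      ((linialGraph n).integralChromatic q : ℤ) =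
        ∑ π : Finpartition (Finset.univ : Finset (Fin n)),
          ((q : ℤ) - (π.parts.card : ℤ) + 1) *
            ∏ B ∈ laterBlocks π, ((q : ℤ) - (π.parts.card : ℤ) + 1 - (lowerDegree π B : ℤ))) ∧
    (∀ q : ℕ, n ≤ q →
      ((linialGraph n).modularChromatic q : ℤ) =
        (q : ℤ) * ∑ π : Finpartition (Finset.univ : Finset (Fin n)),
          ∏ B ∈ laterBlocks π, ((q : ℤ) - (π.parts.card : ℤ) - (lowerDegree π B : ℤ))) ∧
    (linialGraph n).zeroFreeChromatic =
      (X : ℤ[X]) * ∑ π : Finpartition (Finset.univ : Finset (Fin n)),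
        ∏ B ∈ laterBlocks π, ((X : ℤ[X]) - (π.parts.card : ℤ[X]) - (lowerDegree π B : ℤ[X])) ∧
    arrangementCharpoly (linialGraph n).arrangement =
      (X : ℤ[X]) * ∑ π : Finpartition (Finset.univ : Finset (Fin n)),
        ∏ B ∈ laterBlocks π, ((X : ℤ[X]) - (π.parts.card : ℤ[X]) - (lowerDegree π B : ℤ[X])) := by
  have hstar := zeroFreeChromatic_linialGraph hn
  refine ⟨fun q hq => integralChromatic_linialGraph hn q hq,
    fun q hq => modularChromatic_linialGraph hn q hq, hstar, ?_⟩
  rw [IntGainGraph.arrangementCharpoly_arrangement _ (fun e => e.2.ne)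
    (edgeHyperplane_linialGraph_injective n), hstar]
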